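/- **Setting.** Fix $k\ge 1$. A *connection* with $2k$ endpoints is a non-crossing perfect matching of $2k$ fixed points on the boundary circle of a disc; there are $C_k=\frac1{k+1}\binom{2k}{k}$ of them. For $d\in\mathbb C$ let $M^k_{\alpha\beta}=d^{[\alpha,\beta]}$, where $[\alpha,\beta]$ is the number of loops formed by joining $\alpha$ (inside the disc) to $\beta$ (outside). An *operator* with $2k$ endpoints is a complex combination $O=\sum O_{\alpha'\alpha}|\alpha'\rangle\langle\alpha|$; these form a space of dimension $C_k^2$. Let $A,B$ be disjoint discs on the sphere with $2k$ and $2n$ endpoints, and let $\gamma$ be a non-crossing connection of these endpoints in the exterior of both discs (recorded as a perfect matching of the endpoints). Put $$\langle O_AO_B\rangle_\gamma=\sum \bar d^{\,[\alpha'_A\gamma\alpha'_B]}\,d^{\,[\alpha_A\gamma\alpha_B]}\,(O_A)_{\alpha'_A\alpha_A}(O_B)_{\alpha'_B\alpha_B},$$ with $[\alpha_A\gamma\alpha_B]$ the number of loops through $A$ or $B$. $\gamma$ has a *self contact* on $A$ if some strand of $\gamma$ joins two endpoints of $A$, and is *fully extended* if every strand joins $A$ to $B$. An operator $W$ on $A$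 is a *$2k$-leg watermelon operator* if $\langle W\,O_B\rangle_\gamma=0$ for all $n$, all $O_B$ and all $\gamma$ with a self contact on $A$. It has *spin* $l$ ($-k<l\le k$) if $CP_A(W)=e^{i\pi l/k}W$, where $CP_A$ rotates the endpoints by one step. Let $\gamma(O_B)$ denote the operator on $A$ with entries $\gamma(O_B)_{\beta'\beta}=\sum (O_B)_{\alpha'\alpha}\,\bar d^{\,[\gamma\alpha']}d^{\,[\gamma\alpha]}$, the sum being over $\alpha',\alpha$ with $\gamma\circ\alpha'=\beta'$, $\gamma\circ\alpha=\beta$; here $\gamma\circ\alpha$ is the connection of the endpoints of $A$ obtained by erasing the boundary of $B$, and $[\gamma\alpha]$ is the number of closed loops formed that do not meet $A$. A strand of the pair $(\sigma,\sigma')$ of connections is *removable* if it belongs to both $\sigma$ and $\sigma'$ and, on one of its two sides, every endpoint is paired the same way in $\sigma$ and $\sigma'$. The *$k$-loop reconnection operators* are the $|\sigma\rangle\langle\sigma'|$ without removable strands; $S_k$ is the span of the $|\sigma\rangle\langle\sigma'|$ that have a removable strand; the *topological types* of $k$-loop reconnection operators are the classes of the former under rotation of the endpoints. A property holds *for generic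 $d$* if there is a polynomial $p(u,v)$ with integer coefficients, with $p(t,t)$ not identically zero, such that the property holds for every $d\in\mathbb C$ with $p(d,\bar d)\neq0$ (in particular for all but finitely many real $d$). **Theorem.** 1. For each $k\geq 0$, $M^k$ is invertible for all but finitely many $d\in\mathbb C$; hence for all but countably many $d$ all the $M^k$ are invertible. 2. For $k\ge1$ and every $d$, the sum of the images $\{\gamma(O_B)\}$ over all $n$ and all $\gamma$ with a self contact on $A$ is $S_k$. 3. Let $k\ge1$ and let $M^k$ be invertible. The dimension of the space of $2k$-leg watermelon operators equals the number of $k$-loop reconnection operators, and equals $C_k^2-\dim S_k$. The dimension of the space of spin-$0$ watermelon operators equals the number of topological types of $k$-loop reconnection operators. If moreover $|d|^2\le2$ and $g=\arccos(-|d|^2/2)/\pi$, and spin-$l$ watermelon operators are assigned the scaling dimension $x_{2k,l}=\frac{gk^2}2+\frac{l^2}{2gk^2}-\frac{(1-g)^2}{2g}$, then the degeneracy at $x_{2k}=\frac{g^2k^2-(1-g)^2}{2g}$, i.e. $\sum_{-k<l\le k,\ x_{2k,l}=x_{2k}}\dim\{\text{spin-}l\text{ watermelon operators}\}$, equals the number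 of topological types. 4. Let $k\ge1$. For generic $d$: $M^k$ is invertible; for every $k$-loop reconnection operator $R$ there is a unique watermelon operator $W_R$ with $W_R-R\in S_k$, and the $W_R$ form a basis of the space of watermelon operators; for every topological type $t$ there is a unique spin-$0$ watermelon operator $W_t$ with $W_t-\sum_{R\in t}R\in S_k$, and the $W_t$ form a basis of the space of spin-$0$ watermelon operators; and the two-point functions of the spin-$0$ watermelon operators can be diagonalized: their space has a basis $(E_t)$ indexed by the topological types such that, for every fully extended $\gamma$, $\langle E_sE_t\rangle_\gamma\ne0$ if and only if $s=t$. -/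

import Mathlib

open scoped BigOperators ComplexConjugate

noncomputable section

/-- Connections inside (or outside) a disc with `2k` fixed endpoints `0, …, 2k-1`, listed
anticlockwise along its boundary circle: the fixed-point-free involutions of the endpoints
(`α i` is the other end of the strand that starts at `i`) in which no two strands cross. -/
def Connection (k : ℕ) : Type :=
  {α : Fin (2 * k) → Fin (2 * k) // (∀ i, α (α i) = i) ∧ (∀ i, α i ≠ i) ∧
    ∀ i j, ¬ (i < j ∧ j < α i ∧ α i < α j)}

instance (k : ℕ) : DecidableEq (Connection k) :=
  inferInstanceAs (DecidableEq (Subtype _))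

instance (k : ℕ) : Fintype (Connection k) :=
  inferInstanceAs (Fintype (Subtype _))

/-- The set of connected components of the diagram obtained by drawing an edge between `x` and
`p x`, and an edge between `x` and `q x`, for every endpoint `x`. -/
abbrev Components {V : Type} (p q : V → V) : Type :=
  Quot (fun x y : V => p x = y ∨ q x = y)

/-- `[α, β]`: the number of loops formed by joining the strands of `α` (inside the disc) to the
strands of `β` (outside the disc) at the `2k` endpoints. -/
def loopNumber {k : ℕ} (α β : Connection k) : ℕ :=
  Nat.card (Components α.1 β.1)

/-- The overlap matrix `M^k`, with entries `d ^ [α, β]`. -/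
def overlapMatrix (k : ℕ) (d : ℂ) : Matrix (Connection k) (Connection k) ℂ :=
  Matrix.of fun α β => d ^ loopNumber α β

/-! ### Two discs on the sphere and the exterior connections -/

/-- `x, y, z` are distinct and met in this order when going once around the circle anticlockwise. -/
def CyclicallyOrdered {n : ℕ} (x y z : Fin n) : Prop :=
  (x < y ∧ y < z) ∨ (y < z ∧ z < x) ∨ (z < x ∧ x < y)

/-- The connections `γ` of the endpoints of two disjoint discs `A` (with `2m` endpoints) and `B`
(with `2n` endpoints) by non-crossing strands in the exterior of both discs on the sphere.
The endpoints of each disc are listed anticlockwise with respect to that disc. A perfect matching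
is realised by disjoint arcs in the exterior if and only if: two strands with all their
ends on the same disc do not cross; the strands that run from `A` to `B` all lie on the
same side of each strand that returns to its disc; and the strands that run from `A`
to `B` reverse the cyclic order (both circles are oriented around their own disc). -/
structure ExteriorConnection (m n : ℕ) where
  toFun : Fin (2 * m) ⊕ Fin (2 * n) → Fin (2 * m) ⊕ Fin (2 * n)
  involutive : ∀ x, toFun (toFun x) = x
  ne_self : ∀ x, toFun x ≠ x
  noncrossing_A : ∀ i i' j j', toFun (.inl i) = .inl i' → toFun (.inl j) = .inl j' →
    ¬ (i < j ∧ j < i' ∧ i' < j')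
  noncrossing_B : ∀ i i' j j', toFun (.inr i) = .inr i' → toFun (.inr j) = .inr j' →
    ¬ (i < j ∧ j < i' ∧ i' < j')
  same_side_A : ∀ i i' a b x y, toFun (.inl i) = .inl i' → i < i' →
    toFun (.inl a) = .inr x → toFun (.inl b) = .inr y →
    ((i < a ∧ a < i') ↔ (i < b ∧ b < i'))
  same_side_B : ∀ i i' a b x y, toFun (.inr i) = .inr i' → i < i' →
    toFun (.inr a) = .inl x → toFun (.inr b) = .inl y →
    ((i < a ∧ a < i') ↔ (i < b ∧ b < i'))
  reverses_order : ∀ a b c x y z, toFun (.inl a) = .inr x → toFun (.inl b) = .inr y →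
    toFun (.inl c) = .inr z → CyclicallyOrdered a b c → CyclicallyOrdered z y x

namespace ExteriorConnection

variable {m n : ℕ}

/-- `γ` has a self contact on disc `A`: one of its strands joins two endpoints of `A`. -/
def HasSelfContact (γ : ExteriorConnection m n) : Prop :=
  ∃ i j, γ.toFun (.inl i) = .inl j

/-- `γ` is fully extended: every endpoint of `A` is joined to an endpoint of `B`, and conversely. -/
def IsFullyExtended (γ : ExteriorConnection m n) : Prop :=
  (∀ i, ∃ j, γ.toFun (.inl i) = .inr j) ∧ ∀ j, ∃ i, γ.toFun (.inr j) = .inl i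

/-- `[α_A γ α_B]`: the number of loops that pass through `A` or `B`. -/
def totalLoops (α : Connection m) (γ : ExteriorConnection m n) (β : Connection n) : ℕ :=
  Nat.card (Components γ.toFun (Sum.map α.1 β.1))

/-- `[γ α_B]`: the number of closed loops formed by `γ` and `α_B` that do not meet `A`. -/
def closedLoops (γ : ExteriorConnection m n) (β : Connection n) : ℕ :=
  Nat.card {c : Components γ.toFun (Sum.map id β.1) // ∀ i, Quot.mk _ (Sum.inl i) ≠ c}

/-- `γ ∘ α_B = β`: erasing the boundary of `B` from the union of `γ` and `α_B`, the endpoints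
`i` and `β i` of disc `A` are the two ends of the same strand, for every `i`. -/
def ComposesTo (γ : ExteriorConnection m n) (αB : Connection n) (β : Connection m) : Prop :=
  ∀ i, (Quot.mk _ (Sum.inl i) : Components γ.toFun (Sum.map id αB.1)) =
    Quot.mk _ (Sum.inl (β.1 i))

end ExteriorConnection

/-! ### Operators and correlators -/

/-- Operators `∑ O_{α',α} |α'⟩⟨α|` on the states of a disc with `2k` fixed endpoints. The row index
is the outgoing connection and the column index the incoming one. -/
abbrev DiscOperator (k : ℕ) : Type := Matrix (Connection k) (Connection k) ℂ

/-- The topological part `⟨O_A O_B⟩_γ` of the equal-time two-point function. -/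
def correlator (d : ℂ) {m n : ℕ} (γ : ExteriorConnection m n)
    (OA : DiscOperator m) (OB : DiscOperator n) : ℂ :=
  ∑ α' : Connection m, ∑ α : Connection m, ∑ β' : Connection n, ∑ β : Connection n,
    (conj d) ^ γ.totalLoops α' β' * d ^ γ.totalLoops α β * OA α' α * OB β' β

open Classical in
/-- `γ(O_B)`: the operator on connections of disc `A` obtained from the operator `O_B` on `B`
through the exterior connection `γ`. -/
def transport (d : ℂ) {m n : ℕ} (γ : ExteriorConnection m n) (OB : DiscOperator n) :
    DiscOperator m :=
  Matrix.of fun β' β => ∑ α' : Connection n, ∑ α : Connection n,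
    if γ.ComposesTo α' β' ∧ γ.ComposesTo α β then
      OB α' α * (conj d) ^ γ.closedLoops α' * d ^ γ.closedLoops α
    else 0

/-- The span of the images of all exterior connections with a self contact on disc `A`. -/
def selfContactImages (k : ℕ) (d : ℂ) : Submodule ℂ (DiscOperator k) :=
  Submodule.span ℂ {X | ∃ (n : ℕ) (γ : ExteriorConnection k n) (OB : DiscOperator n),
    γ.HasSelfContact ∧ X = transport d γ OB}

/-- The quantum `2k`-leg watermelon operators: the operators `W` on `A` with `⟨W O_B⟩_γ = 0` for
all operators `O_B` on `B` and all `γ` with a self contact on `A`. -/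
def watermelon (k : ℕ) (d : ℂ) : Submodule ℂ (DiscOperator k) where
  carrier := {W | ∀ (n : ℕ) (γ : ExteriorConnection k n), γ.HasSelfContact →
    ∀ OB : DiscOperator n, correlator d γ W OB = 0}
  zero_mem' := by
    intro n γ _ OB
    simp [correlator]
  add_mem' := by
    intro V W hV hW n γ hγ OB
    have h : correlator d γ (V + W) OB = correlator d γ V OB + correlator d γ W OB := by
      simp only [correlator, Matrix.add_apply, mul_add, add_mul, Finset.sum_add_distrib]
    rw [h, hV n γ hγ OB, hW n γ hγ OB, add_zero]
  smul_mem' := by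
    intro c W hW n γ hγ OB
    have h : correlator d γ (c • W) OB = c * correlator d γ W OB := by
      simp only [correlator, Matrix.smul_apply, smul_eq_mul, Finset.mul_sum]
      refine Finset.sum_congr rfl fun _ _ => Finset.sum_congr rfl fun _ _ =>
        Finset.sum_congr rfl fun _ _ => Finset.sum_congr rfl fun _ _ => ?_
      ring
    rw [h, hW n γ hγ OB, mul_zero]

/-! ### Removable strands and reconnection operators -/

/-- The strand that starts at `i` is removable in the pair `(σ, σ')`: it is the same strand in `σ`
and in `σ'`, and on one of its two sides all endpoints carry strands that are not reconnected
either, so that nothing blocks it from being pushed out of the disc on that side. -/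
def IsRemovableStrand {k : ℕ} (σ σ' : Connection k) (i : Fin (2 * k)) : Prop :=
  σ.1 i = σ'.1 i ∧
    ((∀ m, (min i (σ.1 i) < m ∧ m < max i (σ.1 i)) → σ.1 m = σ'.1 m) ∨
     (∀ m, ¬ (min i (σ.1 i) < m ∧ m < max i (σ.1 i)) → σ.1 m = σ'.1 m))

/-- The pair `(σ, σ')` has a removable strand. -/
def HasRemovableStrand {k : ℕ} (r : Connection k × Connection k) : Prop :=
  ∃ i, IsRemovableStrand r.1 r.2 i

/-- The `k`-loop reconnection operators `|σ⟩⟨σ'|` (with `2k` fixed endpoints), represented by the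
pairs `(σ, σ')` without removable strands. -/
abbrev Reconnection (k : ℕ) : Type :=
  {r : Connection k × Connection k // ¬ HasRemovableStrand r}

/-- The operator `|σ⟩⟨σ'|`. -/
def ketBra {k : ℕ} (r : Connection k × Connection k) : DiscOperator k :=
  Matrix.single r.1 r.2 1

/-- The span of the operators `|σ⟩⟨σ'|` with `2k` endpoints that have removable strands, that is, of
those that do not reconnect `k` loops. -/
def removableSpan (k : ℕ) : Submodule ℂ (DiscOperator k) :=
  Submodule.span ℂ (ketBra '' {r | HasRemovableStrand r})

/-! ### Rotations, spin, and topological types -/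

/-- A rotation by one endpoint creates no crossing. -/
theorem noncrossing_rotate {n : ℕ} {α : Fin n → Fin n} (h₁ : ∀ i, α (α i) = i)
    (h₂ : ∀ i j, ¬ (i < j ∧ j < α i ∧ α i < α j)) (i j : Fin n) :
    ¬ (finRotate n i < finRotate n j ∧ finRotate n j < finRotate n (α i) ∧
      finRotate n (α i) < finRotate n (α j)) := by
  rcases n with _ | n
  · exact i.elim0
  · intro h
    have e1 := h₂ i j
    have e2 := h₂ j (α i)
    rw [h₁] at e2
    have ri := coe_finRotate i
    have rj := coe_finRotate j
    have rk := coe_finRotate (α i)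
    have rl := coe_finRotate (α j)
    simp only [Nat.succ_eq_add_one, Fin.lt_def, Fin.ext_iff, Fin.val_last] at ri rj rk rl e1 e2 h
    have b1 := i.isLt
    have b2 := j.isLt
    have b3 := (α i).isLt
    have b4 := (α j).isLt
    split_ifs at ri rj rk rl <;> omega

/-- The connection `ρ ∘ α ∘ ρ⁻¹`, where `ρ i = i + 1` modulo `2k`. -/
def rotateFun {k : ℕ} (α : Connection k) : Connection k :=
  ⟨fun i => finRotate (2 * k) (α.1 ((finRotate (2 * k)).symm i)),
    fun i => by simp only [Equiv.symm_apply_apply, α.2.1, Equiv.apply_symm_apply],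
    fun i h => α.2.2.1 ((finRotate (2 * k)).symm i)
      ((finRotate (2 * k)).eq_symm_apply.mpr h),
    fun i j h => by
      have := noncrossing_rotate α.2.1 α.2.2.2 ((finRotate (2 * k)).symm i)
        ((finRotate (2 * k)).symm j)
      rw [Equiv.apply_symm_apply, Equiv.apply_symm_apply] at this
      exact this h⟩

theorem rotateFun_injective {k : ℕ} :
    Function.Injective (rotateFun : Connection k → Connection k) := by
  intro α β h
  apply Subtype.ext
  funext i
  have h' := congrFun (congrArg Subtype.val h) (finRotate (2 * k) i)
  simp only [rotateFun, Equiv.symm_apply_apply] at h'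
  exact (finRotate (2 * k)).injective h'

/-- The cyclic permutation of the endpoints by one step, acting on connections. -/
def rotate (k : ℕ) : Equiv.Perm (Connection k) :=
  Equiv.ofBijective rotateFun (Finite.injective_iff_bijective.mp rotateFun_injective)

/-- `CP_A` acting on operators: `|σ⟩⟨σ'|` is mapped to `|rotate σ⟩⟨rotate σ'|`. -/
def rotateOperator (k : ℕ) : Module.End ℂ (DiscOperator k) :=
  (Matrix.reindexLinearEquiv ℂ ℂ (rotate k) (rotate k)).toLinearMap

/-- The watermelon operators `W` of spin `l` (modulo `2k`): those with `CP_A(W) = exp(iπl/k) W`. -/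
def spinWatermelon (k : ℕ) (l : ℤ) (d : ℂ) : Submodule ℂ (DiscOperator k) :=
  watermelon k d ⊓
    Module.End.eigenspace (rotateOperator k) (Complex.exp (Complex.I * Real.pi * l / k))

/-- The topological types of `k`-loop reconnection operators: the classes of the pairs `(σ, σ')`
without removable strands, up to rotation. -/
abbrev TopologicalType (k : ℕ) : Type :=
  Quot (fun r s : Reconnection k => s.1 = (rotate k r.1.1, rotate k r.1.2))

open Classical in
/-- The sum of all the operators `|σ⟩⟨σ'|` of a given topological type. -/
def typeSum {k : ℕ} (t : TopologicalType k) : DiscOperator k :=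
  ∑ r : Reconnection k, if Quot.mk _ r = t then ketBra r.1 else 0

/-! ### Scaling dimensions -/

/-- The Coulomb gas coupling `g = arccos(-|d|²/2) / π`. -/
def coupling (d : ℂ) : ℝ := Real.arccos (-(‖d‖ ^ 2 / 2)) / Real.pi

/-- `x_{2k} = (g²k² - (1-g)²) / (2g)`. -/
def scalingDim (g : ℝ) (k : ℕ) : ℝ := (g ^ 2 * k ^ 2 - (1 - g) ^ 2) / (2 * g)

/-- `x_{2k,l} = gk²/2 + l²/(2gk²) - (1-g)²/(2g)`, the dimension of the leading `2k`-leg watermelon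
operators of spin `l`. -/
def spinScalingDim (g : ℝ) (k : ℕ) (l : ℤ) : ℝ :=
  g * k ^ 2 / 2 + l ^ 2 / (2 * g * k ^ 2) - (1 - g) ^ 2 / (2 * g)

open Classical in
/-- The degeneracy at dimension `x_{2k}`: the number of linearly independent `2k`-leg watermelon
operators whose spin `l ∈ {-k+1, …, k}` gives the scaling dimension `x_{2k,l} = x_{2k}`. -/
def degeneracy (k : ℕ) (d : ℂ) : ℕ :=
  ∑ l ∈ (Finset.Ioc (-(k : ℤ)) k).filter
      (fun l => spinScalingDim (coupling d) k l = scalingDim (coupling d) k),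
    Module.finrank ℂ (spinWatermelon k l d)

/-! ### Genericity -/

/-- `P d` holds for generic complex `d`: it holds whenever `p(d, conj d) ≠ 0`, for some polynomial
`p(u, v)` for which the one-variable polynomial `p(t, t)` is not identically zero. In particular the
exceptional set lies in a proper real algebraic subset of `ℂ` that contains only finitely many
real numbers. -/
def ForGeneric (P : ℂ → Prop) : Prop :=
  ∃ p : MvPolynomial (Fin 2) ℤ,
    MvPolynomial.aeval (fun _ => (Polynomial.X : Polynomial ℤ)) p ≠ 0 ∧
    ∀ d : ℂ, MvPolynomial.aeval ![d, conj d] p ≠ 0 → P d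

end

noncomputable section

/-! ### Components of two involutions -/

namespace Components

variable {V W X : Type} {p q : V → V}

/-! The loops of $\alpha_A\gamma\alpha_B$ that meet $A$ are the loops of $\alpha_A$ with
$\gamma\circ\alpha_B$, and the others are the closed loops of $\gamma\alpha_B$: this is
`totalLoops_eq`. Hence $\langle W O_B\rangle_\gamma$ is the pairing of $W$ with $\gamma(O_B)$, and
the values of this pairing on the operators $|\beta'\rangle\langle\beta|$ form the matrix $M(\bar
d)\,W\,M(d)$, called `dual` below (`correlator_eq`).

A pair $(\gamma\circ\beta,\gamma\circ\beta')$ with a self contact of $\gamma$ on $A$ has a removable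
strand, namely that contact (`hasRemovableStrand_compose`). Conversely, a pair with a removable
strand arises by shrinking the disc past that strand, which creates no closed loop
(`exists_excision`). So the self-contact images span $S_k$ for every $d$, and the watermelon
operators are the annihilator of $S_k$ under the pairing (`mem_watermelon_iff`).

If $M^k$ is invertible, `dual` is bijective. A watermelon operator is then given by arbitrary values
of its dual on the reconnection pairs, and a rotation-invariant one by arbitrary values on the
topological types. This yields both dimensions. The scaling dimensions $x_{2k,l}$ and $x_{2k}$
differ by a positive multiple of $l^2$, so only spin 0 contributes to the degeneracy.

Two connections form $k$ loops only if they coincide, and fewer otherwise. In a Gram matrix with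
entries $\bar d^{\,a}d^{\,b}$ the diagonal therefore has strictly the largest degree, and its
determinant is not identically zero (`det_X_pow_ne_zero`). Applied to $M^k$ this gives
invertibility; applied to the Gram matrix of $S_k$ it shows that generically $S_k$ meets its
annihilator only in 0. By dimension the watermelon operators then form a complement of $S_k$, which
produces $W_R$ and $W_t$.

A fully extended $\gamma$ is a reflection of the endpoints up to rotation, so all of them induce one
bilinear form on the spin-0 operators. It is symmetric and, by the existence of the $W_t$,
non-degenerate, hence has an orthogonal basis.

Planarity enters only through combinatorial conditions. That $\gamma\circ\beta$ has no crossings is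
proved by counting points modulo 2 in place of the Jordan curve theorem (`otherEnd_separation`). -/

theorem mk_left (x : V) : (Quot.mk _ (p x) : Components p q) = Quot.mk _ x :=
  (Quot.sound (r := fun x y : V => p x = y ∨ q x = y) (Or.inl rfl)).symm

theorem mk_right (x : V) : (Quot.mk _ (q x) : Components p q) = Quot.mk _ x :=
  (Quot.sound (r := fun x y : V => p x = y ∨ q x = y) (Or.inr rfl)).symm

/-- The usual way to exploit equality of two components: any function invariant under both
involutions descends to the quotient. -/
theorem eq_of_invariant {f : V → X} (hp : ∀ x, f (p x) = f x) (hq : ∀ x, f (q x) = f x) {x y : V}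
    (h : (Quot.mk _ x : Components p q) = Quot.mk _ y) : f x = f y := by
  have h' := congrArg (Quot.lift f (by rintro a b (rfl | rfl) <;> simp [hp, hq])) h
  exact h'

theorem card_congr {p' q' : W → W} (e : V ≃ W) (hp : ∀ x, e (p x) = p' (e x))
    (hq : ∀ x, e (q x) = q' (e x)) : Nat.card (Components p q) = Nat.card (Components p' q') := by
  refine Nat.card_congr (Quot.congr e fun a b => ?_)
  rw [← hp, ← hq, e.apply_eq_iff_eq, e.apply_eq_iff_eq]

theorem card_symm : Nat.card (Components p q) = Nat.card (Components q p) :=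
  Nat.card_congr (Quot.congr (Equiv.refl V) fun a b => by simp [or_comm])

/-- In the orbit of a fixed point of `q` under two involutions `p`, `q`, of which `p` has no fixed
points, there is exactly one more fixed point of `q`. -/
theorem exists_other_fixed [Finite V] (hp : ∀ x, p (p x) = x) (hq : ∀ x, q (q x) = x)
    (hp' : ∀ x, p x ≠ x) {x : V} (hx : q x = x) :
    ∃ y, y ≠ x ∧ q y = y ∧ (Quot.mk _ y : Components p q) = Quot.mk _ x ∧
      ∀ z, q z = z → (Quot.mk _ z : Components p q) = Quot.mk _ x → z = x ∨ z = y := by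
  classical
  -- The involutions generate a dihedral group with rotation `w = P * Q`. As `q` fixes `x`, the
  -- orbit of `x` consists of the points `w ^ j x`, on whose exponents `q` acts by `j ↦ -j` and `p`
  -- by `j ↦ 1 - j`.
  set P : Equiv.Perm V := Function.Involutive.toPerm p hp with hP
  set Q : Equiv.Perm V := Function.Involutive.toPerm q hq with hQ
  set w : Equiv.Perm V := P * Q with hw
  have hPP : P * P = 1 := Equiv.ext hp
  have hQQ : Q * Q = 1 := Equiv.ext hq
  have hPi : P⁻¹ = P := inv_eq_of_mul_eq_one_left hPP
  have hQi : Q⁻¹ = Q := inv_eq_of_mul_eq_one_left hQQ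
  have hQw : Q * w * Q⁻¹ = w⁻¹ := by
    rw [hw, mul_inv_rev, hPi, hQi, mul_assoc, mul_assoc, hQQ, mul_one]
  have hqj : ∀ j : ℤ, q ((w ^ j) x) = (w ^ (-j)) x := by
    intro j
    have h1 : Q * w ^ j * Q⁻¹ = w ^ (-j) := by
      rw [← conj_zpow, hQw, inv_zpow, zpow_neg]
    have h2 : (Q * w ^ j * Q⁻¹) x = q ((w ^ j) x) := by
      rw [hQi]
      exact congrArg (fun v => q ((w ^ j) v)) hx
    rw [← h2, h1]
  have hpj : ∀ j : ℤ, p ((w ^ j) x) = (w ^ (1 - j)) x := by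
    intro j
    have h1 : p ((w ^ j) x) = w (q ((w ^ j) x)) := (congrArg p (hq _)).symm
    rw [h1, hqj, sub_eq_add_neg, zpow_add, zpow_one]
    rfl
  have hmk : ∀ j : ℤ, (Quot.mk _ ((w ^ j) x) : Components p q) = Quot.mk _ x := by
    have hstep : ∀ v, (Quot.mk _ (w v) : Components p q) = Quot.mk _ v := by
      intro v
      have : w v = p (q v) := rfl
      rw [this, mk_left, mk_right]
    intro j
    induction j using Int.induction_on with
    | zero => simp
    | succ i ih => rw [add_comm, zpow_add, zpow_one, Equiv.Perm.mul_apply, hstep, ih]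
    | pred i ih =>
      rw [← hstep, ← ih]
      congr 1
      rw [← Equiv.Perm.mul_apply, ← zpow_one_add]
      congr 2; ring
  have horb : ∀ z, (Quot.mk _ z : Components p q) = Quot.mk _ x → ∃ j : ℤ, z = (w ^ j) x := by
    intro z hz
    have h := eq_of_invariant (p := p) (q := q) (f := fun v => ∃ j : ℤ, v = (w ^ j) x) ?_ ?_ hz
    · rw [h]; exact ⟨0, rfl⟩
    · intro v
      refine propext ⟨?_, ?_⟩
      · rintro ⟨j, hj⟩
        exact ⟨1 - j, by rw [← hpj, ← hj, hp]⟩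
      · rintro ⟨j, rfl⟩
        exact ⟨_, hpj j⟩
    · intro v
      refine propext ⟨?_, ?_⟩
      · rintro ⟨j, hj⟩
        exact ⟨- j, by rw [← hqj, ← hj, hq]⟩
      · rintro ⟨j, rfl⟩
        exact ⟨_, hqj j⟩
  set N := Function.minimalPeriod (w • ·) x with hN
  have hper : ∀ j : ℤ, (w ^ j) x = x ↔ (N : ℤ) ∣ j := fun j =>
    MulAction.zpow_smul_eq_iff_minimalPeriod_dvd (a := w) (b := x) (n := j)
  have heq : ∀ i j : ℤ, (w ^ i) x = (w ^ j) x ↔ (N : ℤ) ∣ i - j := by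
    intro i j
    rw [← hper, sub_eq_neg_add, zpow_add, Equiv.Perm.mul_apply, zpow_neg,
      Equiv.Perm.inv_eq_iff_eq, eq_comm (a := (w ^ i) x)]
  have hNpos : 0 < N := by
    rw [hN]
    apply Function.minimalPeriod_pos_of_mem_periodicPts
    exact (MulAction.injective w).mem_periodicPts x
  -- `q` fixes `w ^ j x` exactly when `N ∣ 2 * j`. For `N = 2 * m` this leaves `x` and `w ^ m x`.
  -- For `N = 2 * m + 1` the point `w ^ (m + 1) x` would be fixed by `p`.
  rcases Nat.even_or_odd' N with ⟨m, hm | hm⟩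
  · refine ⟨(w ^ (m : ℤ)) x, ?_, ?_, hmk _, ?_⟩
    · rw [Ne, hper, hm]
      intro h
      have := Int.le_of_dvd (by omega) h
      omega
    · rw [hqj, heq, hm]
      exact ⟨-1, by push_cast; ring⟩
    · intro z hz hzx
      obtain ⟨j, rfl⟩ := horb z hzx
      rw [hqj, heq, hm] at hz
      obtain ⟨t, ht⟩ := hz
      rw [hper, heq, hm]
      have hj : j = - (m * t) := by push_cast at ht; linarith
      rcases Int.even_or_odd' t with ⟨s, hs | hs⟩
      · left; exact ⟨-s, by rw [hj, hs]; push_cast; ring⟩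
      · right; exact ⟨-s - 1, by rw [hj, hs]; push_cast; ring⟩
  · exfalso
    apply hp' ((w ^ ((m : ℤ) + 1)) x)
    rw [hpj, heq, hm]
    exact ⟨-1, by push_cast; ring⟩

end Components

/-! ### A parity argument for planar pairs of involutions -/

/-- The indicator of `u < x` modulo two. -/
def below {n : ℕ} (x u : Fin n) : ZMod 2 := if u < x then 1 else 0

section Parity

variable {n : ℕ} {β g : Fin n → Fin n} {P : Finset (Fin n)} {a c : Fin n}

/-- No chord from `u` to `β u` separates `x` from `y`, so the two ends of each chord together
contribute an even number to the difference of the counts. -/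
theorem sum_below_eq_of_noncrossing (hβ : ∀ x, β (β x) = x) (hβ' : ∀ x ∈ P, β x ≠ x)
    (hP : ∀ x ∈ P, β x ∈ P) {x y : Fin n}
    (hxy : ∀ u ∈ P, (u < x ∧ x < β u) ↔ (u < y ∧ y < β u)) (hx : x ∉ P) (hy : y ∉ P) :
    ∑ u ∈ P, below x u = ∑ u ∈ P, below y u := by
  have h0 : ∑ u ∈ P, (below x u + below y u) = 0 := by
    refine Finset.sum_involution (fun u _ => β u) ?_ (fun u hu _ => hβ' u hu) (fun u hu => hP u hu)
      (fun u _ => hβ u)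
    intro u hu
    have h1 := hxy u hu
    have h2 := hxy (β u) (hP u hu)
    rw [hβ] at h2
    have hux : u ≠ x := fun h => hx (h ▸ hu)
    have huy : u ≠ y := fun h => hy (h ▸ hu)
    have hbx : β u ≠ x := fun h => hx (h ▸ hP u hu)
    have hby : β u ≠ y := fun h => hy (h ▸ hP u hu)
    have h11 : (1 : ZMod 2) + 1 = 0 := by decide
    unfold below
    rcases lt_or_gt_of_ne hux with h3 | h3 <;> rcases lt_or_gt_of_ne huy with h4 | h4 <;>
    rcases lt_or_gt_of_ne hbx with h5 | h5 <;> rcases lt_or_gt_of_ne hby with h6 | h6 <;>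
    simp [h3, h4, h5, h6, h3.not_gt, h4.not_gt, h5.not_gt, h6.not_gt, h11] at h1 h2 ⊢
  rw [Finset.sum_add_distrib] at h0
  have := eq_neg_of_add_eq_zero_left h0
  rw [this]
  exact ZMod.neg_eq_self_mod_two _

theorem mem_involution_iff (hβ : ∀ x, β (β x) = x) (hP : ∀ x ∈ P, β x ∈ P) {x : Fin n} :
    β x ∈ P ↔ x ∈ P :=
  ⟨fun h => hβ x ▸ hP _ h, hP x⟩

theorem between_iff_of_noncrossing (hβ : ∀ x, β (β x) = x)
    (hnc : ∀ i j, ¬ (i < j ∧ j < β i ∧ β i < β j)) {u x : Fin n} (h1 : u ≠ x) (h2 : β u ≠ x) :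
    (u < x ∧ x < β u) ↔ (u < β x ∧ β x < β u) := by
  have e1 := hnc u x
  have e2 := hnc u (β x)
  have e3 := hnc x u
  have e4 := hnc (β x) u
  have h3 : u ≠ β x := fun h => h2 (by rw [h, hβ])
  have h4 : β u ≠ β x := fun h => h1 (by rw [← hβ u, h, hβ])
  rw [hβ] at e2 e4
  grind

theorem sum_below_involution (hβ : ∀ x, β (β x) = x) (hβ' : ∀ x, β x ≠ x)
    (hnc : ∀ i j, ¬ (i < j ∧ j < β i ∧ β i < β j)) (hP : ∀ x ∈ P, β x ∈ P) {x : Fin n}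
    (hx : x ∉ P) : ∑ u ∈ P, below (β x) u = ∑ u ∈ P, below x u := by
  refine (sum_below_eq_of_noncrossing hβ (fun u _ => hβ' u) hP (fun u hu => ?_) hx
    (by rwa [mem_involution_iff hβ hP])).symm
  exact between_iff_of_noncrossing hβ hnc (fun h => hx (h ▸ hu)) (fun h => hx (h ▸ hP u hu))

/-- Once the two fixed points `a`, `c` are deleted, `g` pairs off the rest of `P` and the previous
count applies. The deleted points give the correction terms. -/
theorem sum_below_eq_add (hg : ∀ x, g (g x) = x) (hP : ∀ x ∈ P, g x ∈ P) (ha : a ∈ P)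
    (hc : c ∈ P) (hga : g a = a) (hgc : g c = c) (hac : a ≠ c)
    (hfix : ∀ u ∈ P, g u = u → u = a ∨ u = c) {x y : Fin n}
    (hxy : ∀ u ∈ P, (u < x ∧ x < g u) ↔ (u < y ∧ y < g u)) (hx : x ∉ P) (hy : y ∉ P) :
    ∑ u ∈ P, below x u + (below x a + below x c) =
      ∑ u ∈ P, below y u + (below y a + below y c) := by
  have h := sum_below_eq_of_noncrossing (β := g) (P := (P.erase a).erase c) hg (fun u hu h => ?_)
    (fun u hu => ?_) (x := x) (y := y) (fun u hu => hxy u ?_) ?_ ?_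
  · have e : ∀ z : Fin n, ∑ u ∈ P, below z u =
        ∑ u ∈ (P.erase a).erase c, below z u + (below z a + below z c) := by
      intro z
      rw [← Finset.sum_erase_add P _ ha,
        ← Finset.sum_erase_add (P.erase a) _ (Finset.mem_erase.mpr ⟨hac.symm, hc⟩)]
      ring
    have h2 : ∀ s t : ZMod 2, s + t + t = s := by decide
    rw [e x, e y, h2, h2, h]
  · simp only [Finset.mem_erase] at hu
    rcases hfix u hu.2.2 h with h | h
    · exact hu.2.1 h
    · exact hu.1 h
  · simp only [Finset.mem_erase] at hu ⊢
    refine ⟨fun h => hu.1 ?_, fun h => hu.2.1 ?_, hP u hu.2.2⟩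
    · rw [← hg u, h, hgc]
    · rw [← hg u, h, hga]
  · simp only [Finset.mem_erase] at hu
    exact hu.2.2
  · simp [hx]
  · simp [hy]

/-- By `hside` the chord from `x` to `g x` does not separate `a` from `c`, so the corrections in
`sum_below_eq_add` agree at its two ends. -/
theorem sum_below_partial_involution (hg : ∀ x, g (g x) = x)
    (hnc : ∀ i j, ¬ (i < j ∧ j < g i ∧ g i < g j))
    (hside : ∀ i a b, i < g i → g a = a → g b = b → ((i < a ∧ a < g i) ↔ (i < b ∧ b < g i)))
    (hP : ∀ x ∈ P, g x ∈ P) (ha : a ∈ P)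
    (hc : c ∈ P) (hga : g a = a) (hgc : g c = c) (hac : a ≠ c)
    (hfix : ∀ u ∈ P, g u = u → u = a ∨ u = c) {x : Fin n} (hx : x ∉ P) :
    ∑ u ∈ P, below (g x) u = ∑ u ∈ P, below x u := by
  have hgx : g x ∉ P := by rwa [mem_involution_iff hg hP]
  have h := sum_below_eq_add hg hP ha hc hga hgc hac hfix (x := x) (y := g x) (fun u hu =>
    between_iff_of_noncrossing hg hnc (fun h => hx (h ▸ hu)) (fun h => hx (h ▸ hP u hu))) hx hgx
  have h2 : below x a + below x c = below (g x) a + below (g x) c := by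
    have hxa : a ≠ x := fun h => hx (h ▸ ha)
    have hxc : c ≠ x := fun h => hx (h ▸ hc)
    have hxa' : a ≠ g x := fun h => hgx (h ▸ ha)
    have hxc' : c ≠ g x := fun h => hgx (h ▸ hc)
    have e1 := hside x a c
    have e2 := hside (g x) a c
    rw [hg] at e2
    have h11 : (1 : ZMod 2) + 1 = 0 := by decide
    unfold below
    rcases lt_or_gt_of_ne hxa with h3 | h3 <;> rcases lt_or_gt_of_ne hxc with h4 | h4 <;>
    rcases lt_or_gt_of_ne hxa' with h5 | h5 <;> rcases lt_or_gt_of_ne hxc' with h6 | h6 <;>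
    simp [h3, h4, h5, h6, h3.not_gt, h4.not_gt, h5.not_gt, h6.not_gt, h11] at e1 e2 ⊢ <;> grind
  rw [h2] at h
  exact (add_right_cancel h).symm

/-- The chords of `g` do not separate its fixed points `b` and `e`, so `sum_below_eq_add` compares
these two. Cancelling the equal parities leaves the statement that `{a, c}` does not separate `b`
from `e` on the circle. -/
theorem separation_parity (hg : ∀ x, g (g x) = x)
    (hside : ∀ i a b, i < g i → g a = a → g b = b → ((i < a ∧ a < g i) ↔ (i < b ∧ b < g i)))
    (hP : ∀ x ∈ P, g x ∈ P) (ha : a ∈ P)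
    (hc : c ∈ P) (hga : g a = a) (hgc : g c = c) (hac : a ≠ c)
    (hfix : ∀ u ∈ P, g u = u → u = a ∨ u = c) {b e : Fin n} (hb : b ∉ P) (he : e ∉ P)
    (hgb : g b = b) (hge : g e = e) (hbe : ∑ u ∈ P, below b u = ∑ u ∈ P, below e u) :
    below b a + below b c = below e a + below e c := by
  have h := sum_below_eq_add hg hP ha hc hga hgc hac hfix (x := b) (y := e) (fun u hu => by
    rcases lt_or_ge u (g u) with h | h
    · exact hside u b e h hgb hge
    · exact ⟨fun h' => absurd (h'.1.trans h'.2) h.not_gt,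
        fun h' => absurd (h'.1.trans h'.2) h.not_gt⟩) hb he
  rw [hbe] at h
  exact add_left_cancel h

end Parity

end

noncomputable section

/-! ### Composition of an exterior connection with a connection of the disc `B` -/

namespace ExteriorConnection

variable {m n : ℕ} (γ : ExteriorConnection m n) (β : Connection n)

theorem sumMap_involutive (x : Fin (2 * m) ⊕ Fin (2 * n)) :
    Sum.map id β.1 (Sum.map id β.1 x) = x := by
  rcases x with x | x <;> simp [β.2.1]

/-- The endpoints of `A` are exactly the fixed points of `Sum.map id β.1`, so a component that meets
`A` is a path with two ends there. -/
theorem exists_other_end (i : Fin (2 * m)) : ∃ j, j ≠ i ∧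
    (Quot.mk _ (Sum.inl j) : Components γ.toFun (Sum.map id β.1)) = Quot.mk _ (Sum.inl i) ∧
    ∀ z, (Quot.mk _ (Sum.inl z) : Components γ.toFun (Sum.map id β.1)) = Quot.mk _ (Sum.inl i) →
      z = i ∨ z = j := by
  obtain ⟨y, hy1, hy2, hy3, hy4⟩ := Components.exists_other_fixed γ.involutive
    (sumMap_involutive β) γ.ne_self (x := Sum.inl i) rfl
  rcases y with j | b
  · refine ⟨j, fun h => hy1 (by rw [h]), hy3, fun z hz => ?_⟩
    rcases hy4 (Sum.inl z) rfl hz with h | h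
    · exact Or.inl (Sum.inl_injective h)
    · exact Or.inr (Sum.inl_injective h)
  · exact absurd (Sum.inr_injective hy2) (β.2.2.1 b)

/-- The other end on `A` of the strand of `γ ∘ β` that starts at `i`. -/
def otherEnd (i : Fin (2 * m)) : Fin (2 * m) := (γ.exists_other_end β i).choose

theorem otherEnd_ne (i : Fin (2 * m)) : γ.otherEnd β i ≠ i :=
  (γ.exists_other_end β i).choose_spec.1

theorem mk_otherEnd (i : Fin (2 * m)) :
    (Quot.mk _ (Sum.inl (γ.otherEnd β i)) : Components γ.toFun (Sum.map id β.1)) =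
      Quot.mk _ (Sum.inl i) :=
  (γ.exists_other_end β i).choose_spec.2.1

variable {γ β}

theorem eq_or_eq_otherEnd {i z : Fin (2 * m)}
    (h : (Quot.mk _ (Sum.inl z) : Components γ.toFun (Sum.map id β.1)) = Quot.mk _ (Sum.inl i)) :
    z = i ∨ z = γ.otherEnd β i :=
  (γ.exists_other_end β i).choose_spec.2.2 z h

theorem otherEnd_involutive (i : Fin (2 * m)) : γ.otherEnd β (γ.otherEnd β i) = i :=
  (eq_or_eq_otherEnd ((γ.mk_otherEnd β _).trans (γ.mk_otherEnd β i))).resolve_right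
    (γ.otherEnd_ne β _)

theorem otherEnd_eq_of_inl {i j : Fin (2 * m)} (h : γ.toFun (.inl i) = .inl j) :
    γ.otherEnd β i = j := by
  have h1 := Components.mk_left (p := γ.toFun) (q := Sum.map id β.1) (Sum.inl i)
  rw [h] at h1
  rcases eq_or_eq_otherEnd h1 with h2 | h2
  · exact absurd (by rw [h, h2]) (γ.ne_self (.inl i))
  · exact h2.symm

/-- The strands of `γ` on the disc `B`, where the ends of the strands to `A` are fixed. -/
def onB (γ : ExteriorConnection m n) (b : Fin (2 * n)) : Fin (2 * n) :=
  Sum.elim (fun _ => b) id (γ.toFun (.inr b))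

theorem onB_of_inl {b : Fin (2 * n)} {i} (h : γ.toFun (.inr b) = .inl i) : γ.onB b = b := by
  simp [onB, h]

theorem onB_of_inr {b b' : Fin (2 * n)} (h : γ.toFun (.inr b) = .inr b') : γ.onB b = b' := by
  simp [onB, h]

theorem exists_inl_of_onB_eq {b : Fin (2 * n)} (h : γ.onB b = b) :
    ∃ i, γ.toFun (.inr b) = .inl i := by
  rcases hb : γ.toFun (.inr b) with i | b'
  · exact ⟨i, rfl⟩
  · rw [onB_of_inr hb] at h
    exact absurd (by rw [hb, h]) (γ.ne_self (.inr b))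

theorem exists_inr_of_onB_ne {b : Fin (2 * n)} (h : γ.onB b ≠ b) :
    γ.toFun (.inr b) = .inr (γ.onB b) := by
  rcases hb : γ.toFun (.inr b) with i | b'
  · exact absurd (onB_of_inl hb) h
  · rw [onB_of_inr hb]

theorem onB_involutive (b : Fin (2 * n)) : γ.onB (γ.onB b) = b := by
  by_cases h : γ.onB b = b
  · rw [h, h]
  · have h1 := exists_inr_of_onB_ne h
    exact onB_of_inr (by rw [← h1, γ.involutive])

theorem onB_noncrossing (i j : Fin (2 * n)) :
    ¬ (i < j ∧ j < γ.onB i ∧ γ.onB i < γ.onB j) := by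
  rintro ⟨h1, h2, h3⟩
  exact γ.noncrossing_B i _ j _ (exists_inr_of_onB_ne (h1.trans h2).ne')
    (exists_inr_of_onB_ne (h2.trans h3).ne') ⟨h1, h2, h3⟩

theorem onB_side (i a b : Fin (2 * n)) (hi : i < γ.onB i) (ha : γ.onB a = a) (hb : γ.onB b = b) :
    (i < a ∧ a < γ.onB i) ↔ (i < b ∧ b < γ.onB i) := by
  obtain ⟨x, hx⟩ := exists_inl_of_onB_eq ha
  obtain ⟨y, hy⟩ := exists_inl_of_onB_eq hb
  exact γ.same_side_B i _ a b x y (exists_inr_of_onB_ne hi.ne') hi hx hy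

theorem mk_onB (b : Fin (2 * n)) :
    (Quot.mk _ (Sum.inr (γ.onB b)) : Components γ.toFun (Sum.map id β.1)) =
      Quot.mk _ (Sum.inr b) := by
  by_cases h : γ.onB b = b
  · rw [h]
  · rw [← exists_inr_of_onB_ne h, Components.mk_left]

theorem toFun_symm {x y} (h : γ.toFun x = y) : γ.toFun y = x := by rw [← h, γ.involutive]

/-- A discrete Jordan curve argument. Let `P` be the set of endpoints of `B` on the strand of `γ ∘
β` through `i`. Off `P`, the parity of the number of points of `P` below a point is unchanged along
`β` and along the strands of `γ` that return to `B`, hence along the whole strand through `j`. It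
therefore agrees at `b` and `e`, and `separation_parity` applies. -/
theorem otherEnd_separation {i j : Fin (2 * m)} {a b c e : Fin (2 * n)}
    (ha : γ.toFun (.inl i) = .inr a) (hc : γ.toFun (.inl (γ.otherEnd β i)) = .inr c)
    (hb : γ.toFun (.inl j) = .inr b) (he : γ.toFun (.inl (γ.otherEnd β j)) = .inr e)
    (hij : j ≠ i) (hij' : j ≠ γ.otherEnd β i) :
    below b a + below b c = below e a + below e c := by
  classical
  set P : Finset (Fin (2 * n)) := Finset.univ.filter fun u =>
    (Quot.mk _ (Sum.inr u) : Components γ.toFun (Sum.map id β.1)) = Quot.mk _ (Sum.inl i) with hP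
  have hmem : ∀ u, u ∈ P ↔ (Quot.mk _ (Sum.inr u) : Components γ.toFun (Sum.map id β.1)) =
      Quot.mk _ (Sum.inl i) := by simp [hP]
  have hend : ∀ {x y}, γ.toFun (.inl x) = .inr y →
      (Quot.mk _ (Sum.inr y) : Components γ.toFun (Sum.map id β.1)) = Quot.mk _ (Sum.inl x) := by
    intro x y h
    rw [← h, Components.mk_left]
  have hPg : ∀ u ∈ P, γ.onB u ∈ P := by
    intro u hu
    rw [hmem] at hu ⊢
    rw [mk_onB, hu]
  have hPβ : ∀ u ∈ P, β.1 u ∈ P := by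
    intro u hu
    rw [hmem] at hu ⊢
    rw [← hu]
    exact Components.mk_right (p := γ.toFun) (q := Sum.map id β.1) (Sum.inr u)
  have haP : a ∈ P := (hmem a).mpr (hend ha)
  have hcP : c ∈ P := (hmem c).mpr ((hend hc).trans (γ.mk_otherEnd β i))
  have hbP : b ∉ P := by
    rw [hmem, hend hb]
    intro h
    rcases eq_or_eq_otherEnd h with h | h
    · exact hij h
    · exact hij' h
  have heP : e ∉ P := by
    rw [hmem, hend he, mk_otherEnd]
    intro h
    rcases eq_or_eq_otherEnd h with h | h
    · exact hij h
    · exact hij' h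
  have hac : a ≠ c := by
    rintro rfl
    have h := (toFun_symm ha).symm.trans (toFun_symm hc)
    exact γ.otherEnd_ne β i (Sum.inl_injective h).symm
  have hfix : ∀ u ∈ P, γ.onB u = u → u = a ∨ u = c := by
    intro u hu hu'
    obtain ⟨x, hx⟩ := exists_inl_of_onB_eq hu'
    have hx' := toFun_symm hx
    rw [hmem, hend hx'] at hu
    rcases eq_or_eq_otherEnd hu with rfl | rfl
    · left; exact Sum.inr_injective (hx'.symm.trans ha)
    · right; exact Sum.inr_injective (hx'.symm.trans hc)
  have hga := onB_of_inl (toFun_symm ha)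
  have hgc := onB_of_inl (toFun_symm hc)
  have hgb := onB_of_inl (toFun_symm hb)
  have hge := onB_of_inl (toFun_symm he)
  refine separation_parity (g := γ.onB) (P := P) onB_involutive onB_side hPg haP hcP hga hgc hac
    hfix hbP heP hgb hge ?_
  set N : Fin (2 * n) → ZMod 2 := fun x => if x ∈ P then 0 else ∑ u ∈ P, below x u with hN
  have hNβ : ∀ x, N (β.1 x) = N x := by
    intro x
    simp only [hN, mem_involution_iff β.2.1 hPβ]
    split_ifs with h
    · rfl
    · exact sum_below_involution β.2.1 β.2.2.1 β.2.2.2 hPβ h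
  have hNg : ∀ x, N (γ.onB x) = N x := by
    intro x
    simp only [hN, mem_involution_iff (onB_involutive (γ := γ)) hPg]
    split_ifs with h
    · rfl
    · exact sum_below_partial_involution onB_involutive onB_noncrossing onB_side hPg haP hcP hga
        hgc hac hfix h
  -- At an endpoint of `A` the function takes its value at the end on `B` of the strand of `γ`, and
  -- 0 if that strand returns to `A`. This makes it invariant under `γ`.
  have hinv := Components.eq_of_invariant (p := γ.toFun) (q := Sum.map id β.1)
    (f := fun v => Sum.elim (fun x => Sum.elim (fun _ => 0) N (γ.toFun (.inl x))) N v) ?_ ?_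
    ((hend hb).trans ((γ.mk_otherEnd β j).symm.trans (hend he).symm))
  · simpa [hN, hbP, heP] using hinv
  · rintro (x | x)
    · rcases hx : γ.toFun (.inl x) with y | y
      · simp [hx, toFun_symm hx]
      · simp [hx]
    · rcases hx : γ.toFun (.inr x) with y | y
      · simp [toFun_symm hx]
      · simp [← onB_of_inr hx, hNg]
  · rintro (x | x)
    · rfl
    · exact hNβ x

theorem otherEnd_noncrossing (i j : Fin (2 * m)) :
    ¬ (i < j ∧ j < γ.otherEnd β i ∧ γ.otherEnd β i < γ.otherEnd β j) := by
  rintro ⟨h1, h2, h3⟩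
  -- If `γ` joined the other end to a point of `A`, that point would have to be `x`, whose strand
  -- leads to `B`.
  have hback : ∀ {x y}, γ.toFun (.inl x) = .inr y →
      ∃ z, γ.toFun (.inl (γ.otherEnd β x)) = .inr z := by
    intro x y hx
    rcases hz : γ.toFun (.inl (γ.otherEnd β x)) with z | z
    · have := otherEnd_eq_of_inl (β := β) hz
      rw [otherEnd_involutive] at this
      rw [← this] at hz
      rw [toFun_symm hz] at hx
      exact absurd hx (by simp)
    · exact ⟨z, rfl⟩
  rcases hi : γ.toFun (.inl i) with i' | a <;> rcases hj : γ.toFun (.inl j) with j' | b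
  · have e1 := otherEnd_eq_of_inl (β := β) hi
    have e2 := otherEnd_eq_of_inl (β := β) hj
    exact γ.noncrossing_A i i' j j' hi hj (by rw [← e1, ← e2]; exact ⟨h1, h2, h3⟩)
  · obtain ⟨e, he⟩ := hback hj
    have e1 := otherEnd_eq_of_inl (β := β) hi
    have := γ.same_side_A i i' j _ b e hi (by rw [← e1]; exact h1.trans h2) hj he
    rw [← e1] at this
    exact absurd (this.mp ⟨h1, h2⟩).2 h3.not_gt
  · obtain ⟨c, hc⟩ := hback hi
    have e1 := otherEnd_eq_of_inl (β := β) hj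
    have := γ.same_side_A j j' i _ a c hj (by rw [← e1]; exact h2.trans h3) hi hc
    rw [← e1] at this
    exact absurd (this.mpr ⟨h2, h3⟩).1 h1.not_gt
  · obtain ⟨c, hc⟩ := hback hi
    obtain ⟨e, he⟩ := hback hj
    have h := otherEnd_separation hi hc hj he h1.ne' h2.ne
    -- Reversal of the cyclic order puts `b` on the arc from `c` to `a` and `e` on the arc from `a`
    -- to `c`, so `{a, c}` does separate `b` from `e`.
    have r1 := γ.reverses_order i j _ a b c hi hj hc (Or.inl ⟨h1, h2⟩)
    have r2 := γ.reverses_order i _ _ a c e hi hc he (Or.inl ⟨h1.trans h2, h3⟩)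
    have h11 : (1 : ZMod 2) + 1 = 0 := by decide
    unfold below at h
    unfold CyclicallyOrdered at r1 r2
    split_ifs at h <;> simp [h11] at h <;> omega

/-- The connection `γ ∘ β` of the endpoints of `A`. -/
def compose (γ : ExteriorConnection m n) (β : Connection n) : Connection m :=
  ⟨γ.otherEnd β, otherEnd_involutive, γ.otherEnd_ne β, otherEnd_noncrossing⟩

theorem composesTo_iff {σ : Connection m} : γ.ComposesTo β σ ↔ γ.compose β = σ := by
  constructor
  · intro h
    apply Subtype.ext
    funext i
    rcases eq_or_eq_otherEnd (h i).symm with h1 | h1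
    · exact absurd h1 (σ.2.2.1 i)
    · exact h1.symm
  · rintro rfl i
    exact (γ.mk_otherEnd β i).symm

theorem compose_apply_of_inl {i j : Fin (2 * m)} (h : γ.toFun (.inl i) = .inl j) :
    (γ.compose β).1 i = j := otherEnd_eq_of_inl h

/-! ### Counting loops -/

/-- Loops through `A` are loops of `α` with `γ ∘ β`, since replacing each path of `γ` and `β`
between endpoints of `A` by a single strand loses nothing. The remaining loops never see `α`. -/
theorem totalLoops_eq (α : Connection m) (γ : ExteriorConnection m n) (β : Connection n) :
    γ.totalLoops α β = loopNumber α (γ.compose β) + γ.closedLoops β := by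
  classical
  set σ := γ.compose β with hσ
  let C := Components γ.toFun (Sum.map id β.1)
  let D := Components γ.toFun (Sum.map α.1 β.1)
  let E := Components α.1 σ.1
  let Z := {c : C // ∀ i, Quot.mk _ (Sum.inl i) ≠ c}
  -- A path is sent to the class of either of its ends on `A`. The choice is immaterial, because `σ`
  -- joins the two ends.
  let φ : C → E ⊕ Z := fun c =>
    if h : ∃ i, Quot.mk _ (Sum.inl i) = c then .inl (Quot.mk _ h.choose)
    else .inr ⟨c, fun i hi => h ⟨i, hi⟩⟩
  have hφ : ∀ i, φ (Quot.mk _ (Sum.inl i)) = .inl (Quot.mk _ i) := by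
    intro i
    have h : ∃ j, (Quot.mk _ (Sum.inl j) : C) = Quot.mk _ (Sum.inl i) := ⟨i, rfl⟩
    simp only [φ, dif_pos h]
    rcases eq_or_eq_otherEnd h.choose_spec with h1 | h1
    · rw [h1]
    · rw [h1]
      exact congrArg Sum.inl (Components.mk_right (p := α.1) (q := σ.1) i)
  let f : D → E ⊕ Z := Quot.lift (fun v => φ (Quot.mk _ v)) (by
    rintro a b (rfl | rfl)
    · simp only [Components.mk_left]
    · rcases a with a | a
      · simp only [Sum.map_inl, hφ]
        exact congrArg Sum.inl (Components.mk_left (p := α.1) (q := σ.1) a).symm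
      · exact congrArg φ (Components.mk_right (p := γ.toFun) (q := Sum.map id β.1)
          (Sum.inr a)).symm)
  -- The diagram left open at `A` has finer components than the one closed by `α`.
  have hCD : ∀ v w, (Quot.mk _ v : C) = Quot.mk _ w → (Quot.mk _ v : D) = Quot.mk _ w := by
    intro v w h
    refine Components.eq_of_invariant (f := fun v => (Quot.mk _ v : D)) ?_ ?_ h
    · intro x; exact Components.mk_left x
    · rintro (x | x)
      · rfl
      · exact Components.mk_right (p := γ.toFun) (q := Sum.map α.1 β.1) (Sum.inr x)
  let b : E ⊕ Z → D := Sum.elim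
    (Quot.lift (fun i => Quot.mk _ (Sum.inl i)) (by
      rintro a b (rfl | rfl)
      · exact (Components.mk_right (p := γ.toFun) (q := Sum.map α.1 β.1) (Sum.inl a)).symm
      · exact hCD _ _ (γ.mk_otherEnd β a).symm))
    (fun z => Quot.lift (fun v => (Quot.mk _ v : D)) (by
      intro a b h
      exact hCD _ _ (Quot.sound h)) z.1)
  have hbf : ∀ d, b (f d) = d := by
    intro d
    induction d using Quot.ind with
    | mk v =>
    change b (φ (Quot.mk _ v)) = _
    by_cases h : ∃ i, (Quot.mk _ (Sum.inl i) : C) = Quot.mk _ v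
    · obtain ⟨i, hi⟩ := h
      rw [← hi, hφ]
      exact hCD _ _ hi
    · simp only [φ, dif_neg h]
      rfl
  have hfb : ∀ e, f (b e) = e := by
    rintro (e | ⟨z, hz⟩)
    · induction e using Quot.ind with
      | mk i => exact hφ i
    · induction z using Quot.ind with
      | mk v =>
      have h : ¬ ∃ i, (Quot.mk _ (Sum.inl i) : C) = Quot.mk _ v := fun ⟨i, hi⟩ => hz i hi
      change φ (Quot.mk _ v) = _
      simp only [φ, dif_neg h]
  have hcard := Nat.card_congr (Equiv.mk f b hbf hfb)
  rw [Nat.card_sum] at hcard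
  exact hcard

end ExteriorConnection

end

noncomputable section

/-! ### Removable strands and self contacts -/

theorem even_card_of_involution {V : Type} [DecidableEq V] {f : V → V} (S : Finset V)
    (hf : ∀ x ∈ S, f (f x) = x) (hf' : ∀ x ∈ S, f x ≠ x) (hS : ∀ x ∈ S, f x ∈ S) :
    Even S.card := by
  have h : ∑ _u ∈ S, (1 : ZMod 2) = 0 :=
    Finset.sum_involution (fun u _ => f u) (fun _ _ => by decide) (fun u hu _ => hf' u hu)
      hS hf
  rw [Finset.sum_const, nsmul_eq_mul, mul_one] at h
  exact (ZMod.natCast_eq_zero_iff_even).mp h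

namespace ExteriorConnection

variable {k n : ℕ}

/-! ### Shrinking the disc: cutting an exterior connection out of a connection -/

section Excision

variable (σ : Connection k) (κ : Fin (2 * n) → Fin (2 * k))

open Classical in
/-- The strands of `σ` off the range of `κ`, and strands from the range of `κ` to `B`. -/
def exciseFun : Fin (2 * k) ⊕ Fin (2 * n) → Fin (2 * k) ⊕ Fin (2 * n) :=
  Sum.elim (fun i => if h : ∃ j, κ j = i then .inr h.choose else .inl (σ.1 i))
    (fun j => .inl (κ j))

variable {σ κ}

theorem exciseFun_of_notMem {i : Fin (2 * k)} (h : i ∉ Set.range κ) :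
    exciseFun σ κ (.inl i) = .inl (σ.1 i) := by
  have h' : ¬ ∃ j, κ j = i := h
  simp [exciseFun, h']

theorem exciseFun_apply (hκ : StrictAnti κ) (j : Fin (2 * n)) :
    exciseFun σ κ (.inl (κ j)) = .inr j := by
  have h : ∃ j', κ j' = κ j := ⟨j, rfl⟩
  simp only [exciseFun, Sum.elim_inl, dif_pos h]
  exact congrArg Sum.inr (hκ.injective h.choose_spec)

theorem exciseFun_inl_eq_inl (hκ : StrictAnti κ) {i i' : Fin (2 * k)}
    (h : exciseFun σ κ (.inl i) = .inl i') : i ∉ Set.range κ ∧ σ.1 i = i' := by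
  by_cases hi : i ∈ Set.range κ
  · obtain ⟨j, rfl⟩ := hi
    rw [exciseFun_apply hκ] at h
    exact absurd h (by simp)
  · rw [exciseFun_of_notMem hi] at h
    exact ⟨hi, Sum.inl_injective h⟩

theorem exciseFun_inl_eq_inr (hκ : StrictAnti κ) {i : Fin (2 * k)} {j : Fin (2 * n)}
    (h : exciseFun σ κ (.inl i) = .inr j) : i = κ j := by
  by_cases hi : i ∈ Set.range κ
  · obtain ⟨j, rfl⟩ := hi
    rw [exciseFun_apply hκ] at h
    rw [Sum.inr_injective h]
  · rw [exciseFun_of_notMem hi] at h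
    exact absurd h (by simp)

/-- The exterior connection that keeps the strands of `σ` off the range of `κ`. -/
def excise (σ : Connection k) (κ : Fin (2 * n) → Fin (2 * k)) (hκ : StrictAnti κ)
    (hσ : ∀ i, i ∈ Set.range κ → σ.1 i ∈ Set.range κ)
    (hside : ∀ i, i ∉ Set.range κ → i < σ.1 i → ∀ a ∈ Set.range κ, ∀ b ∈ Set.range κ,
      ((i < a ∧ a < σ.1 i) ↔ (i < b ∧ b < σ.1 i))) : ExteriorConnection k n where
  toFun := exciseFun σ κ
  involutive := by
    rintro (i | j)
    · by_cases hi : i ∈ Set.range κ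
      · obtain ⟨j, rfl⟩ := hi
        rw [exciseFun_apply hκ]
        rfl
      · rw [exciseFun_of_notMem hi, exciseFun_of_notMem (fun h => hi (by
          have := hσ _ h
          rwa [σ.2.1] at this)), σ.2.1]
    · exact exciseFun_apply hκ j
  ne_self := by
    rintro (i | j)
    · intro h
      exact σ.2.2.1 i (exciseFun_inl_eq_inl hκ h).2
    · simp [exciseFun]
  noncrossing_A := by
    intro i i' j j' hi hj
    obtain ⟨-, rfl⟩ := exciseFun_inl_eq_inl hκ hi
    obtain ⟨-, rfl⟩ := exciseFun_inl_eq_inl hκ hj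
    exact σ.2.2.2 i j
  noncrossing_B := by
    intro i i' j j' hi
    exact absurd hi (by simp [exciseFun])
  same_side_A := by
    intro i i' a b x y hi hlt ha hb
    obtain ⟨hi1, rfl⟩ := exciseFun_inl_eq_inl hκ hi
    exact hside i hi1 hlt a ⟨x, (exciseFun_inl_eq_inr hκ ha).symm⟩
      b ⟨y, (exciseFun_inl_eq_inr hκ hb).symm⟩
  same_side_B := by
    intro i i' a b x y hi
    exact absurd hi (by simp [exciseFun])
  reverses_order := by
    intro a b c x y z ha hb hc h
    rw [exciseFun_inl_eq_inr hκ ha, exciseFun_inl_eq_inr hκ hb, exciseFun_inl_eq_inr hκ hc] at h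
    simp only [CyclicallyOrdered, hκ.lt_iff_gt] at h ⊢
    tauto

/-- The restriction of `τ` to the range of `κ`. -/
theorem exists_restriction (hκ : StrictAnti κ) (τ : Connection k)
    (hτ : ∀ i, i ∈ Set.range κ → τ.1 i ∈ Set.range κ) :
    ∃ β : Connection n, ∀ j, κ (β.1 j) = τ.1 (κ j) := by
  choose f hf using fun j => hτ (κ j) ⟨j, rfl⟩
  refine ⟨⟨f, fun j => hκ.injective ?_, fun j h => τ.2.2.1 (κ j) ?_, ?_⟩, hf⟩
  · rw [hf, hf, τ.2.1]
  · rw [← hf, h]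
  · rintro i j ⟨h1, h2, h3⟩
    refine τ.2.2.2 (κ (f j)) (κ (f i)) ⟨hκ h3, ?_, ?_⟩
    · rw [hf j, τ.2.1]; exact hκ h2
    · rw [hf j, hf i, τ.2.1, τ.2.1]; exact hκ h1

variable {hκ : StrictAnti κ} {hσ : ∀ i, i ∈ Set.range κ → σ.1 i ∈ Set.range κ}
    {hside : ∀ i, i ∉ Set.range κ → i < σ.1 i → ∀ a ∈ Set.range κ, ∀ b ∈ Set.range κ,
      ((i < a ∧ a < σ.1 i) ↔ (i < b ∧ b < σ.1 i))}

theorem excise_composesTo {τ : Connection k} {β : Connection n}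
    (hβ : ∀ j, κ (β.1 j) = τ.1 (κ j)) (hτ : ∀ i, i ∉ Set.range κ → τ.1 i = σ.1 i) :
    (excise σ κ hκ hσ hside).ComposesTo β τ := by
  intro i
  by_cases hi : i ∈ Set.range κ
  · obtain ⟨j, rfl⟩ := hi
    have h1 := Components.mk_left (p := (excise σ κ hκ hσ hside).toFun) (q := Sum.map id β.1)
      (Sum.inr j)
    have h2 := Components.mk_left (p := (excise σ κ hκ hσ hside).toFun) (q := Sum.map id β.1)
      (Sum.inr (β.1 j))
    have h3 := Components.mk_right (p := (excise σ κ hκ hσ hside).toFun) (q := Sum.map id β.1)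
      (Sum.inr j)
    rw [← hβ]
    exact h1.trans (h3.symm.trans h2.symm)
  · have h1 := Components.mk_left (p := (excise σ κ hκ hσ hside).toFun) (q := Sum.map id β.1)
      (Sum.inl i)
    rw [hτ i hi, ← exciseFun_of_notMem hi]
    exact h1.symm

end Excision

theorem closedLoops_eq_zero {m : ℕ} {γ : ExteriorConnection m n} (β : Connection n)
    (h : ∀ j, ∃ i, γ.toFun (.inr j) = .inl i) : γ.closedLoops β = 0 := by
  have : IsEmpty {c : Components γ.toFun (Sum.map id β.1) // ∀ i, Quot.mk _ (Sum.inl i) ≠ c} := by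
    refine ⟨fun ⟨c, hc⟩ => ?_⟩
    induction c using Quot.ind with
    | mk v =>
    rcases v with i | j
    · exact hc i rfl
    · obtain ⟨i, hi⟩ := h j
      apply hc i
      rw [← hi]
      exact Components.mk_left _
  exact Nat.card_of_isEmpty

end ExteriorConnection

open ExteriorConnection

variable {k : ℕ}

/-- Two connections that agree off a stable set `S` on one side of the other strands arise from
connections of a smaller disc `B` through a common exterior connection. -/
theorem exists_excision_of_agree_off (σ σ' : Connection k) (S : Finset (Fin (2 * k)))
    (i : Fin (2 * k)) (hi : i ∉ S) (hS : ∀ x ∈ S, σ.1 x ∈ S) (hagree : ∀ x, x ∉ S → σ.1 x = σ'.1 x)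
    (hside : ∀ i, i ∉ S → i < σ.1 i → ∀ a ∈ S, ∀ b ∈ S,
      ((i < a ∧ a < σ.1 i) ↔ (i < b ∧ b < σ.1 i))) :
    ∃ (n : ℕ) (γ : ExteriorConnection k n) (β β' : Connection n), γ.HasSelfContact ∧
      γ.compose β = σ ∧ γ.compose β' = σ' ∧ ∀ b, γ.closedLoops b = 0 := by
  have hS' : ∀ x, σ.1 x ∈ S → x ∈ S := fun x hx => by
    have := hS _ hx
    rwa [σ.2.1] at this
  have hSσ' : ∀ x ∈ S, σ'.1 x ∈ S := by
    intro x hx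
    by_contra h
    have h1 := hagree _ h
    rw [σ'.2.1] at h1
    exact h (hS' _ (by rw [h1]; exact hx))
  obtain ⟨n, hn⟩ := even_card_of_involution S (fun x _ => σ.2.1 x) (fun x _ => σ.2.2.1 x) hS
  rw [← two_mul] at hn
  -- The points of `S` are listed in decreasing order because strands between the two discs reverse
  -- the cyclic order.
  set κ : Fin (2 * n) → Fin (2 * k) := fun j => S.orderEmbOfFin hn (Fin.rev j)
  have hκ : StrictAnti κ := fun a b hab =>
    (S.orderEmbOfFin hn).strictMono (Fin.rev_lt_rev.mpr hab)
  have hrange : ∀ x, x ∈ Set.range κ ↔ x ∈ S := by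
    intro x
    have h1 : Set.range κ = Set.range (S.orderEmbOfFin hn) :=
      Fin.revPerm.surjective.range_comp (S.orderEmbOfFin hn)
    rw [h1, Finset.range_orderEmbOfFin, Finset.mem_coe]
  have hσκ : ∀ i, i ∈ Set.range κ → σ.1 i ∈ Set.range κ := by simpa only [hrange] using hS
  have hσκ' : ∀ i, i ∈ Set.range κ → σ'.1 i ∈ Set.range κ := by simpa only [hrange] using hSσ'
  have hsideκ : ∀ i, i ∉ Set.range κ → i < σ.1 i → ∀ a ∈ Set.range κ, ∀ b ∈ Set.range κ,
      ((i < a ∧ a < σ.1 i) ↔ (i < b ∧ b < σ.1 i)) := by simpa only [hrange] using hside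
  obtain ⟨β, hβ⟩ := exists_restriction hκ σ hσκ
  obtain ⟨β', hβ'⟩ := exists_restriction hκ σ' hσκ'
  refine ⟨n, excise σ κ hκ hσκ hsideκ, β, β', ⟨i, σ.1 i, ?_⟩, ?_, ?_, fun b => ?_⟩
  · exact exciseFun_of_notMem (by rwa [hrange])
  · exact composesTo_iff.mp (excise_composesTo hβ fun _ _ => rfl)
  · exact composesTo_iff.mp (excise_composesTo hβ' fun x hx => by
      rw [hrange] at hx; exact (hagree x hx).symm)
  · exact closedLoops_eq_zero b fun j => ⟨κ j, rfl⟩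

/-- The removable strand `u`–`v` and all strands on its unreconnected side are common to both
connections, so they can be left outside a smaller disc that contains only the other side. -/
theorem exists_excision {r : Connection k × Connection k} (hr : HasRemovableStrand r) :
    ∃ (n : ℕ) (γ : ExteriorConnection k n) (β β' : Connection n), γ.HasSelfContact ∧
      γ.compose β = r.1 ∧ γ.compose β' = r.2 ∧ ∀ b, γ.closedLoops b = 0 := by
  obtain ⟨σ, σ'⟩ := r
  obtain ⟨i, hi, hr⟩ := hr
  simp only at hi hr
  have key : ∃ lo hi : Fin (2 * k), lo < hi ∧ σ.1 lo = hi ∧ min i (σ.1 i) = lo ∧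
      max i (σ.1 i) = hi ∧ σ'.1 lo = hi := by
    rcases lt_or_gt_of_ne (σ.2.2.1 i) with h | h
    · exact ⟨σ.1 i, i, h, σ.2.1 i, min_eq_right h.le, max_eq_left h.le, by rw [hi, σ'.2.1]⟩
    · exact ⟨i, σ.1 i, h, rfl, min_eq_left h.le, max_eq_right h.le, hi.symm⟩
  obtain ⟨u, v, huv, hu, hmin, hmax, hu'⟩ := key
  rw [hmin, hmax] at hr
  have hv : σ.1 v = u := by rw [← hu, σ.2.1]
  have hv' : σ'.1 v = u := by rw [← hu', σ'.2.1]
  have hnc : ∀ x, x ≠ u → x ≠ v → ((u < x ∧ x < v) ↔ (u < σ.1 x ∧ σ.1 x < v)) := by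
    intro x hxu hxv
    have := between_iff_of_noncrossing σ.2.1 σ.2.2.2 (u := u) (x := x) hxu.symm
      (by rw [hu]; exact hxv.symm)
    rwa [hu] at this
  rcases hr with hr | hr
  -- Agreement inside the chord: the smaller disc keeps the endpoints outside `[u, v]`, and no
  -- strand left behind encloses any of them.
  · refine exists_excision_of_agree_off σ σ' (Finset.univ.filter fun x => x < u ∨ v < x) u
      (by simp [huv.le]) ?_ ?_ ?_
    · intro x
      have h1 := hnc x
      have h2 : x ≠ u → x ≠ v → σ.1 x ≠ u ∧ σ.1 x ≠ v := fun h3 h4 =>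
        ⟨fun h => h4 (by rw [← hu, ← h, σ.2.1]), fun h => h3 (by rw [← hv, ← h, σ.2.1])⟩
      simp only [Finset.mem_filter, Finset.mem_univ, true_and]
      grind
    · intro x hx
      simp only [Finset.mem_filter, Finset.mem_univ, true_and, not_or, not_lt] at hx
      by_cases h1 : x = u
      · rw [h1, hu, hu']
      by_cases h2 : x = v
      · rw [h2, hv, hv']
      exact hr x ⟨lt_of_le_of_ne hx.1 (Ne.symm h1), lt_of_le_of_ne hx.2 h2⟩
    · intro x hx hlt a ha b hb
      have h1 := hnc x
      simp only [Finset.mem_filter, Finset.mem_univ, true_and] at hx ha hb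
      grind
  -- Agreement outside the chord: the smaller disc keeps the endpoints strictly between `u` and `v`,
  -- and each strand left behind encloses all of them or none.
  · refine exists_excision_of_agree_off σ σ' (Finset.univ.filter fun x => u < x ∧ x < v) u (by simp)
      ?_ ?_ ?_
    · intro x
      have h1 := hnc x
      simp only [Finset.mem_filter, Finset.mem_univ, true_and]
      grind
    · intro x hx
      simp only [Finset.mem_filter, Finset.mem_univ, true_and] at hx
      exact hr x hx
    · intro x hx hlt a ha b hb
      have h1 := hnc x
      have h2 := σ.2.2.2 x u
      have h3 := σ.2.2.2 u x
      simp only [Finset.mem_filter, Finset.mem_univ, true_and] at hx ha hb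
      grind

/-- All strands from `A` to `B` lie on one side of the self contact. On its other side every strand
belongs to `γ`, so it is the same in both compositions. -/
theorem hasRemovableStrand_compose {n : ℕ} {γ : ExteriorConnection k n} (hγ : γ.HasSelfContact)
    (β β' : Connection n) : HasRemovableStrand (γ.compose β, γ.compose β') := by
  have key : ∃ i j, γ.toFun (.inl i) = .inl j ∧ i < j := by
    obtain ⟨i, j, h⟩ := hγ
    rcases lt_trichotomy i j with h1 | h1 | h1
    · exact ⟨i, j, h, h1⟩
    · exact absurd (by rw [h, h1]) (γ.ne_self (.inl i))
    · exact ⟨j, i, toFun_symm h, h1⟩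
  obtain ⟨i, j, hij, hlt⟩ := key
  refine ⟨i, ?_, ?_⟩
  · rw [compose_apply_of_inl hij, compose_apply_of_inl hij]
  simp only [compose_apply_of_inl hij, min_eq_left hlt.le, max_eq_right hlt.le]
  have hA : ∀ x y, γ.toFun (.inl x) = .inl y → (γ.compose β).1 x = (γ.compose β').1 x := by
    intro x y h
    rw [compose_apply_of_inl h, compose_apply_of_inl h]
  by_cases h : ∃ a y, γ.toFun (.inl a) = .inr y ∧ (i < a ∧ a < j)
  · obtain ⟨a, y, ha, hb⟩ := h
    right
    intro x hx
    rcases h : γ.toFun (.inl x) with z | z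
    · exact hA _ _ h
    · exact absurd ((γ.same_side_A i j a x y z hij hlt ha h).mp hb) hx
  · left
    intro x hx
    rcases h' : γ.toFun (.inl x) with z | z
    · exact hA _ _ h'
    · exact absurd ⟨x, z, h', hx⟩ h

theorem transport_apply (d : ℂ) {m n : ℕ} (γ : ExteriorConnection m n) (OB : DiscOperator n)
    (σ σ' : Connection m) :
    transport d γ OB σ σ' = ∑ α' : Connection n, ∑ α : Connection n,
      if γ.compose α' = σ ∧ γ.compose α = σ' then
        OB α' α * (conj d) ^ γ.closedLoops α' * d ^ γ.closedLoops α
      else 0 := by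
  simp only [transport, Matrix.of_apply, composesTo_iff]

theorem mem_removableSpan_iff {X : DiscOperator k} :
    X ∈ removableSpan k ↔ ∀ σ σ', ¬ HasRemovableStrand (σ, σ') → X σ σ' = 0 := by
  constructor
  · intro h σ σ' hr
    unfold removableSpan at h
    induction h using Submodule.span_induction with
    | mem x hx =>
      obtain ⟨r, hr', rfl⟩ := hx
      simp only [ketBra, Matrix.single_apply]
      rw [if_neg]
      rintro ⟨rfl, rfl⟩
      exact hr hr'
    | zero => rfl
    | add x y _ _ hx hy => rw [Matrix.add_apply, hx, hy, add_zero]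
    | smul a x _ hx => rw [Matrix.smul_apply, hx, smul_zero]
  · intro h
    rw [Matrix.matrix_eq_sum_single X]
    refine Submodule.sum_mem _ fun σ _ => Submodule.sum_mem _ fun σ' _ => ?_
    by_cases hr : HasRemovableStrand (σ, σ')
    · have : Matrix.single σ σ' (X σ σ') = X σ σ' • ketBra (σ, σ') := by
        simp [ketBra, Matrix.smul_single]
      rw [this]
      exact Submodule.smul_mem _ _ (Submodule.subset_span ⟨_, hr, rfl⟩)
    · rw [h σ σ' hr, Matrix.single_zero]
      exact Submodule.zero_mem _

/-- For the inclusion of $S_k$, excision provides `γ` without closed loops that carries one `ketBra`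
to another with coefficient 1, whatever `d` is. -/
theorem selfContactImages_eq (k : ℕ) (d : ℂ) : selfContactImages k d = removableSpan k := by
  apply le_antisymm
  · refine Submodule.span_le.mpr ?_
    rintro X ⟨n, γ, OB, hγ, rfl⟩
    rw [SetLike.mem_coe, mem_removableSpan_iff]
    intro σ σ' hr
    rw [transport_apply]
    refine Finset.sum_eq_zero fun α' _ => Finset.sum_eq_zero fun α _ => if_neg ?_
    rintro ⟨rfl, rfl⟩
    exact hr (hasRemovableStrand_compose hγ _ _)
  · refine Submodule.span_le.mpr ?_
    rintro X ⟨r, hr, rfl⟩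
    obtain ⟨n, γ, β, β', hγ, h1, h2, h3⟩ := exists_excision hr
    refine Submodule.subset_span ⟨n, γ, ketBra (β, β'), hγ, ?_⟩
    ext σ σ'
    rw [transport_apply, Finset.sum_eq_single β, Finset.sum_eq_single β']
    · simp [ketBra, Matrix.single_apply, h1, h2, h3]
    · intro b _ hb
      simp [ketBra, hb.symm]
    · simp
    · intro b _ hb
      refine Finset.sum_eq_zero fun c _ => ?_
      simp [ketBra, hb.symm]
    · simp

end

noncomputable section

/-! ### Loop numbers and determinants -/

namespace Components

variable {V : Type} [Fintype V] {p q : V → V}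

theorem card_eq_sum_fiber [DecidableEq (Components p q)] [Fintype (Components p q)] :
    Fintype.card V = ∑ c : Components p q,
      (Finset.univ.filter fun y : V => (Quot.mk _ y : Components p q) = c).card :=
  Finset.card_eq_sum_card_fiberwise (fun _ _ => Finset.mem_coe.mpr (Finset.mem_univ _))

theorem two_mul_card_self (hp : ∀ x, p (p x) = x) (hp' : ∀ x, p x ≠ x) :
    2 * Nat.card (Components p p) = Fintype.card V := by
  classical
  have : Fintype (Components p p) := Fintype.ofFinite _
  rw [card_eq_sum_fiber (p := p) (q := p), Nat.card_eq_fintype_card, mul_comm, ← smul_eq_mul,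
    ← Finset.card_univ, ← Finset.sum_const]
  refine Finset.sum_congr rfl fun c _ => ?_
  induction c using Quot.ind with
  | mk x =>
  rw [← Finset.card_pair (hp' x).symm]
  congr 1
  ext y
  simp only [Finset.mem_insert, Finset.mem_singleton, Finset.mem_filter, Finset.mem_univ, true_and]
  constructor
  · rintro (rfl | rfl)
    · rfl
    · exact mk_left x
  · intro h
    have h1 : ({y, p y} : Set V) = {x, p x} := eq_of_invariant (f := fun x => ({x, p x} : Set V))
      (fun x => by simp only [hp]; exact Set.pair_comm _ _)
      (fun x => by simp only [hp]; exact Set.pair_comm _ _) h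
    have h2 : y ∈ ({x, p x} : Set V) := h1 ▸ Set.mem_insert _ _
    exact h2

/-- Every component contains some `x` and `p x`, and one where `p` and `q` differ contains the third
point `q x`. -/
theorem two_mul_card_lt (hp' : ∀ x, p x ≠ x) (hq' : ∀ x, q x ≠ x) (hpq : p ≠ q) :
    2 * Nat.card (Components p q) < Fintype.card V := by
  classical
  have : Fintype (Components p q) := Fintype.ofFinite _
  obtain ⟨x, hx⟩ := Function.ne_iff.mp hpq
  rw [card_eq_sum_fiber (p := p) (q := q), Nat.card_eq_fintype_card, mul_comm, ← smul_eq_mul,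
    ← Finset.card_univ, ← Finset.sum_const]
  refine Finset.sum_lt_sum (fun c _ => ?_) ⟨Quot.mk _ x, Finset.mem_univ _, ?_⟩
  · induction c using Quot.ind with
    | mk x =>
    rw [← Finset.card_pair (hp' x).symm]
    refine Finset.card_le_card fun y hy => ?_
    simp only [Finset.mem_insert, Finset.mem_singleton] at hy
    simp only [Finset.mem_filter, Finset.mem_univ, true_and]
    rcases hy with rfl | rfl
    · rfl
    · exact mk_left x
  · have h3 : ({x, p x, q x} : Finset V).card = 3 := by
      rw [Finset.card_eq_three]
      exact ⟨x, p x, q x, (hp' x).symm, (hq' x).symm, hx, rfl⟩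
    refine lt_of_lt_of_le (by norm_num : 2 < 3) (h3 ▸ Finset.card_le_card fun y hy => ?_)
    simp only [Finset.mem_insert, Finset.mem_singleton] at hy
    simp only [Finset.mem_filter, Finset.mem_univ, true_and]
    rcases hy with rfl | rfl | rfl
    · rfl
    · exact mk_left x
    · exact mk_right x

end Components

section LoopNumber

variable {k : ℕ}

theorem loopNumber_comm (α β : Connection k) : loopNumber α β = loopNumber β α :=
  Components.card_symm

theorem loopNumber_self (α : Connection k) : loopNumber α α = k := by
  have h : 2 * loopNumber α α = Fintype.card (Fin (2 * k)) :=
    Components.two_mul_card_self α.2.1 α.2.2.1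
  rw [Fintype.card_fin] at h
  omega

theorem loopNumber_lt {α β : Connection k} (hαβ : α ≠ β) : loopNumber α β < k := by
  have h : 2 * loopNumber α β < Fintype.card (Fin (2 * k)) :=
    Components.two_mul_card_lt α.2.2.1 β.2.2.1 fun h => hαβ (Subtype.ext h)
  rw [Fintype.card_fin] at h
  omega

theorem loopNumber_le (α β : Connection k) : loopNumber α β ≤ k := by
  by_cases h : α = β
  · rw [h, loopNumber_self]
  · exact (loopNumber_lt h).le

end LoopNumber

/-- At `t = card ι + 1` the matrix is strictly diagonally dominant: an off-diagonal row sum is at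
most `card ι * t ^ (N - 1)`, below the diagonal entry `t ^ N`. If `N = 0` there are no off-diagonal
entries. -/
theorem det_X_pow_ne_zero {ι : Type} [Fintype ι] [DecidableEq ι] (e : ι → ι → ℕ) (N : ℕ)
    (hd : ∀ i, e i i = N) (ho : ∀ i j, i ≠ j → e i j < N) :
    (Matrix.of fun i j => (Polynomial.X : Polynomial ℤ) ^ e i j).det ≠ 0 := by
  intro h
  set t : ℝ := Fintype.card ι + 1 with ht
  have ht1 : 1 ≤ t := by rw [ht]; linarith [Nat.cast_nonneg (α := ℝ) (Fintype.card ι)]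
  have h1 : (Matrix.of fun i j => t ^ e i j).det = 0 := by
    have h2 := congrArg (Polynomial.aeval (R := ℤ) t) h
    rw [AlgHom.map_det, map_zero] at h2
    rw [← h2]
    congr 1
    ext i j
    simp
  refine det_ne_zero_of_sum_row_lt_diag (fun i => ?_) h1
  have hnorm : ∀ m : ℕ, ‖t ^ m‖ = t ^ m := fun m =>
    Real.norm_of_nonneg (pow_nonneg (by linarith) m)
  simp only [Matrix.of_apply, hnorm, hd]
  rcases N with _ | N
  · rw [Finset.sum_eq_zero]
    · simp
    · intro j hj
      exact absurd (ho i j (Finset.ne_of_mem_erase hj).symm) (Nat.not_lt_zero _)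
  · calc ∑ j ∈ Finset.univ.erase i, t ^ e i j ≤ ∑ _j ∈ Finset.univ.erase i, t ^ N :=
          Finset.sum_le_sum fun j hj => pow_le_pow_right₀ ht1
            (Nat.lt_succ_iff.mp (ho i j (Finset.ne_of_mem_erase hj).symm))
      _ = (Finset.univ.erase i).card * t ^ N := by rw [Finset.sum_const, nsmul_eq_mul]
      _ < t * t ^ N := by
          refine mul_lt_mul_of_pos_right ?_ (by positivity)
          rw [ht]
          have : ((Finset.univ.erase i).card : ℝ) ≤ Fintype.card ι := by
            exact_mod_cast Finset.card_le_univ _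
          linarith
      _ = t ^ (N + 1) := (pow_succ' t N).symm

theorem isUnit_overlapMatrix_iff (k : ℕ) (d : ℂ) :
    IsUnit (overlapMatrix k d) ↔ (overlapMatrix k d).det ≠ 0 := by
  rw [Matrix.isUnit_iff_isUnit_det, isUnit_iff_ne_zero]

theorem finite_not_isUnit_overlapMatrix (k : ℕ) :
    {d : ℂ | ¬ IsUnit (overlapMatrix k d)}.Finite := by
  set p : Polynomial ℤ := (Matrix.of fun α β : Connection k =>
    (Polynomial.X : Polynomial ℤ) ^ loopNumber α β).det with hp
  have hp0 : p ≠ 0 :=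
    det_X_pow_ne_zero loopNumber k loopNumber_self fun _ _ => loopNumber_lt
  refine Set.Finite.subset (Polynomial.rootSet_finite p ℂ) fun d hd => ?_
  simp only [Set.mem_ofPred_eq, isUnit_overlapMatrix_iff, not_not] at hd
  rw [Polynomial.mem_rootSet]
  refine ⟨hp0, ?_⟩
  rw [hp, AlgHom.map_det, ← hd]
  congr 1
  ext i j
  simp [overlapMatrix]

theorem countable_not_isUnit_overlapMatrix :
    {d : ℂ | ∃ k : ℕ, ¬ IsUnit (overlapMatrix k d)}.Countable := by
  rw [Set.ofPred_exists]
  exact Set.countable_iUnion fun k => (finite_not_isUnit_overlapMatrix k).countable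

/-- The Gram matrix of the operators with a removable strand. -/
def removableGram (k : ℕ) (d : ℂ) :
    Matrix {r : Connection k × Connection k // HasRemovableStrand r}
      {r : Connection k × Connection k // HasRemovableStrand r} ℂ :=
  Matrix.of fun r s => (conj d) ^ loopNumber r.1.1 s.1.1 * d ^ loopNumber r.1.2 s.1.2

theorem ForGeneric.mono {P Q : ℂ → Prop} (h : ForGeneric P) (hPQ : ∀ d, P d → Q d) :
    ForGeneric Q := by
  obtain ⟨p, hp, h⟩ := h
  exact ⟨p, hp, fun d hd => hPQ d (h d hd)⟩

theorem ForGeneric.and {P Q : ℂ → Prop} (hP : ForGeneric P) (hQ : ForGeneric Q) :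
    ForGeneric fun d => P d ∧ Q d := by
  obtain ⟨p, hp, hP⟩ := hP
  obtain ⟨q, hq, hQ⟩ := hQ
  refine ⟨p * q, by rw [map_mul]; exact mul_ne_zero hp hq, fun d hd => ?_⟩
  rw [map_mul] at hd
  exact ⟨hP d (left_ne_zero_of_mul hd), hQ d (right_ne_zero_of_mul hd)⟩

/-- The polynomial is the determinant itself, with `X 0` standing for `d` and `X 1` for its
conjugate. On the diagonal $u=v=t$ the two exponents add up. -/
theorem forGeneric_det_ne_zero {ι : Type} [Fintype ι] [DecidableEq ι] (a b : ι → ι → ℕ) (N : ℕ)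
    (hd : ∀ i, a i i + b i i = N) (ho : ∀ i j, i ≠ j → a i j + b i j < N) :
    ForGeneric fun d => (Matrix.of fun i j => (conj d) ^ a i j * d ^ b i j).det ≠ 0 := by
  refine ⟨(Matrix.of fun i j => (MvPolynomial.X 1 : MvPolynomial (Fin 2) ℤ) ^ a i j *
    MvPolynomial.X 0 ^ b i j).det, ?_, fun d hd => ?_⟩
  · rw [AlgHom.map_det]
    convert det_X_pow_ne_zero (fun i j => a i j + b i j) N hd ho using 2
    ext i j : 2
    simp [pow_add]
  · rw [AlgHom.map_det] at hd
    convert hd using 2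
    ext i j
    simp

theorem forGeneric_isUnit_overlapMatrix (k : ℕ) :
    ForGeneric fun d => IsUnit (overlapMatrix k d) := by
  have h := forGeneric_det_ne_zero (fun _ _ => 0) (loopNumber (k := k)) k
    (fun α => by rw [zero_add, loopNumber_self]) fun α β h => by rw [zero_add]; exact loopNumber_lt h
  refine h.mono fun d hd => ?_
  rw [isUnit_overlapMatrix_iff]
  simpa [overlapMatrix] using hd

open Classical in
theorem forGeneric_removableGram (k : ℕ) :
    ForGeneric fun d => (removableGram k d).det ≠ 0 := by
  refine forGeneric_det_ne_zero
    (ι := {r : Connection k × Connection k // HasRemovableStrand r})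
    (fun r s => loopNumber r.1.1 s.1.1)
    (fun r s => loopNumber r.1.2 s.1.2) (k + k) (fun r => ?_) fun r s h => ?_
  · rw [loopNumber_self, loopNumber_self]
  · by_cases h1 : r.1.1 = s.1.1
    · have h2 : r.1.2 ≠ s.1.2 := fun h2 => h (Subtype.ext (Prod.ext h1 h2))
      exact add_lt_add_of_le_of_lt (loopNumber_le _ _) (loopNumber_lt h2)
    · exact add_lt_add_of_lt_of_le (loopNumber_lt h1) (loopNumber_le _ _)

end

noncomputable section

/-! ### Counting connections -/

/-- Non-crossing perfect matchings of `{0, …, n - 1}`, extended by the identity to `ℕ`. -/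
structure IsNoncrossing (n : ℕ) (f : ℕ → ℕ) : Prop where
  lt : ∀ x < n, f x < n
  involutive : ∀ x < n, f (f x) = x
  ne_self : ∀ x < n, f x ≠ x
  eq_self : ∀ x, n ≤ x → f x = x
  noncrossing : ∀ i < n, ∀ j < n, ¬ (i < j ∧ j < f i ∧ f i < f j)

/-- A connection, seen as a function on `ℕ`. -/
def connectionEquiv (k : ℕ) : Connection k ≃ {f : ℕ → ℕ // IsNoncrossing (2 * k) f} where
  toFun α := ⟨fun x => if h : x < 2 * k then α.1 ⟨x, h⟩ else x, by
    refine ⟨fun x hx => ?_, fun x hx => ?_, fun x hx => ?_, fun x hx => ?_, fun i hi j hj => ?_⟩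
    · simp [hx]
    · rw [dif_pos hx, dif_pos (α.1 _).isLt, Fin.eta, α.2.1]
    · rw [dif_pos hx]
      exact fun h => α.2.2.1 ⟨x, hx⟩ (Fin.ext h)
    · simp [hx.not_gt]
    · rw [dif_pos hi, dif_pos hj]
      exact α.2.2.2 ⟨i, hi⟩ ⟨j, hj⟩⟩
  invFun f := ⟨fun x => ⟨f.1 x, f.2.lt x x.2⟩, fun x => Fin.ext (f.2.involutive x x.2),
    fun x h => f.2.ne_self x x.2 (congrArg Fin.val h),
    fun i j h => f.2.noncrossing i i.2 j j.2 h⟩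
  left_inv α := by
    apply Subtype.ext
    funext x
    simp
  right_inv f := by
    apply Subtype.ext
    funext x
    by_cases h : x < 2 * k
    · simp [h]
    · simp only [h, dif_neg, not_false_eq_true]
      exact (f.2.eq_self x (not_lt.mp h)).symm

/-- The points strictly between `0` and `f 0` are paired among themselves, so there is an even
number of them. -/
theorem IsNoncrossing.exists_eq {k : ℕ} {f : ℕ → ℕ} (hf : IsNoncrossing (2 * (k + 1)) f) :
    ∃ i ≤ k, f 0 = 2 * i + 1 := by
  have h0 := hf.lt 0 (by omega)
  have h1 := hf.ne_self 0 (by omega)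
  have h2 := even_card_of_involution (f := f) (Finset.Ioo 0 (f 0))
    (fun x hx => hf.involutive x (by simp at hx; omega))
    (fun x hx => hf.ne_self x (by simp at hx; omega)) (fun x hx => by
      simp only [Finset.mem_Ioo] at hx ⊢
      have hx' : x < 2 * (k + 1) := by omega
      have e1 := hf.noncrossing 0 (by omega) x hx'
      have e2 := hf.involutive x hx'
      have e3 := hf.involutive 0 (by omega)
      have e4 : f x ≠ 0 := fun h => by rw [h] at e2; omega
      have e5 : f x ≠ f 0 := fun h => by rw [h, e3] at e2; omega
      omega)
  rw [Nat.card_Ioo] at h2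
  obtain ⟨i, hi⟩ := h2
  exact ⟨i, by omega, by omega⟩

/-- The strand of the point `0` splits a matching into its inner and its outer part. -/
theorem IsNoncrossing.inner {i j : ℕ} {f : ℕ → ℕ} (hf : IsNoncrossing (2 * (i + j + 1)) f)
    (h0 : f 0 = 2 * i + 1) {x : ℕ} (hx : 0 < x ∧ x < 2 * i + 1) : 0 < f x ∧ f x < 2 * i + 1 := by
  have hx' : x < 2 * (i + j + 1) := by omega
  have e1 := hf.noncrossing 0 (by omega) x hx'
  have e2 := hf.involutive x hx'
  have e3 := hf.involutive 0 (by omega)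
  have e4 : f x ≠ 0 := fun h => by rw [h] at e2; omega
  have e5 : f x ≠ f 0 := fun h => by rw [h, e3] at e2; omega
  omega

theorem IsNoncrossing.outer {i j : ℕ} {f : ℕ → ℕ} (hf : IsNoncrossing (2 * (i + j + 1)) f)
    (h0 : f 0 = 2 * i + 1) {x : ℕ} (hx : 2 * i + 2 ≤ x) : 2 * i + 2 ≤ f x := by
  by_cases hx' : x < 2 * (i + j + 1)
  · by_contra h
    have e2 := hf.involutive x hx'
    have e3 := hf.involutive 0 (by omega)
    have e4 : f x ≠ 0 := fun h => by rw [h] at e2; omega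
    have e5 : f x ≠ f 0 := fun h => by rw [h, e3] at e2; omega
    have := hf.inner h0 (x := f x) (by omega)
    omega
  · rw [hf.eq_self x (by omega)]; exact hx

/-- The matching in which `0` is joined to `2i + 1`, with inner part `g` and outer part `h`. -/
def joinMatching (i : ℕ) (g h : ℕ → ℕ) (x : ℕ) : ℕ :=
  if x = 0 then 2 * i + 1 else if x ≤ 2 * i then g (x - 1) + 1
  else if x = 2 * i + 1 then 0 else h (x - (2 * i + 2)) + (2 * i + 2)

theorem joinMatching_zero (i : ℕ) (g h : ℕ → ℕ) : joinMatching i g h 0 = 2 * i + 1 := by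
  simp [joinMatching]

theorem joinMatching_mid (i : ℕ) (g h : ℕ → ℕ) : joinMatching i g h (2 * i + 1) = 0 := by
  simp [joinMatching]

theorem joinMatching_inner {i : ℕ} (g h : ℕ → ℕ) {x : ℕ} (hx : x < 2 * i) :
    joinMatching i g h (x + 1) = g x + 1 := by
  have h1 : x + 1 ≤ 2 * i := hx
  simp [joinMatching, h1]

theorem joinMatching_outer (i : ℕ) (g h : ℕ → ℕ) (x : ℕ) :
    joinMatching i g h (x + (2 * i + 2)) = h x + (2 * i + 2) := by
  have h1 : ¬ (x + (2 * i + 2) ≤ 2 * i) := by omega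
  have h2 : x + (2 * i + 2) ≠ 2 * i + 1 := by omega
  have h3 : x + (2 * i + 2) ≠ 0 := by omega
  simp only [joinMatching, h1, h2, h3, if_false, Nat.add_sub_cancel]

theorem cases_of_join (i x : ℕ) :
    x = 0 ∨ x = 2 * i + 1 ∨ (∃ y < 2 * i, x = y + 1) ∨ ∃ y, x = y + (2 * i + 2) := by
  by_cases h1 : x = 0
  · exact Or.inl h1
  by_cases h2 : x = 2 * i + 1
  · exact Or.inr (Or.inl h2)
  by_cases h3 : x ≤ 2 * i
  · exact Or.inr (Or.inr (Or.inl ⟨x - 1, by omega, by omega⟩))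
  · exact Or.inr (Or.inr (Or.inr ⟨x - (2 * i + 2), by omega⟩))

theorem isNoncrossing_join {i j : ℕ} {g h : ℕ → ℕ} (hg : IsNoncrossing (2 * i) g)
    (hh : IsNoncrossing (2 * j) h) : IsNoncrossing (2 * (i + j + 1)) (joinMatching i g h) := by
  refine ⟨fun x hx => ?_, fun x hx => ?_, fun x hx => ?_, fun x hx => ?_, fun x hx y hy => ?_⟩
  · rcases cases_of_join i x with rfl | rfl | ⟨y, hy, rfl⟩ | ⟨y, rfl⟩
    · rw [joinMatching_zero]; omega
    · rw [joinMatching_mid]; omega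
    · rw [joinMatching_inner g h hy]
      have := hg.lt y hy
      omega
    · rw [joinMatching_outer]
      have := hh.lt y (by omega)
      omega
  · rcases cases_of_join i x with rfl | rfl | ⟨y, hy, rfl⟩ | ⟨y, rfl⟩
    · rw [joinMatching_zero, joinMatching_mid]
    · rw [joinMatching_mid, joinMatching_zero]
    · rw [joinMatching_inner g h hy, joinMatching_inner g h (hg.lt y hy), hg.involutive y hy]
    · rw [joinMatching_outer, joinMatching_outer, hh.involutive y (by omega)]
  · rcases cases_of_join i x with rfl | rfl | ⟨y, hy, rfl⟩ | ⟨y, rfl⟩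
    · rw [joinMatching_zero]; omega
    · rw [joinMatching_mid]; omega
    · rw [joinMatching_inner g h hy]
      have := hg.ne_self y hy
      omega
    · rw [joinMatching_outer]
      have := hh.ne_self y (by omega)
      omega
  · rcases cases_of_join i x with rfl | rfl | ⟨y, hy, rfl⟩ | ⟨y, rfl⟩
    · omega
    · omega
    · omega
    · rw [joinMatching_outer, hh.eq_self y (by omega)]
  · rcases cases_of_join i x with rfl | rfl | ⟨x, hx', rfl⟩ | ⟨x, rfl⟩ <;>
    rcases cases_of_join i y with rfl | rfl | ⟨y, hy', rfl⟩ | ⟨y, rfl⟩ <;>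
    simp only [joinMatching_zero, joinMatching_mid, joinMatching_outer, joinMatching_inner, *]
    all_goals try omega
    · have := hg.lt y hy'
      omega
    · have := hg.noncrossing x hx' y hy'
      omega
    · have := hg.lt x hx'
      omega
    · have := hh.noncrossing x (by omega) y (by omega)
      omega

theorem isNoncrossing_innerPart {i j : ℕ} {f : ℕ → ℕ} (hf : IsNoncrossing (2 * (i + j + 1)) f)
    (h0 : f 0 = 2 * i + 1) :
    IsNoncrossing (2 * i) fun x => if x < 2 * i then f (x + 1) - 1 else x := by
  have hin : ∀ x < 2 * i, 0 < f (x + 1) ∧ f (x + 1) < 2 * i + 1 := fun x hx =>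
    hf.inner h0 (by omega)
  refine ⟨fun x hx => ?_, fun x hx => ?_, fun x hx => ?_, fun x hx => ?_, fun x hx y hy => ?_⟩
  · have := hin x hx
    simp only [hx, if_true]
    omega
  · have := hin x hx
    have h1 : f (x + 1) - 1 < 2 * i := by omega
    simp only [hx, if_true, h1]
    rw [Nat.sub_add_cancel this.1, hf.involutive _ (by omega)]
    rfl
  · have := hin x hx
    have h1 := hf.ne_self (x + 1) (by omega)
    simp only [hx, if_true]
    omega
  · simp [hx.not_gt]
  · have := hin x hx
    have := hin y hy
    have := hf.noncrossing (x + 1) (by omega) (y + 1) (by omega)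
    simp only [hx, hy, if_true]
    omega

theorem isNoncrossing_outerPart {i j : ℕ} {f : ℕ → ℕ} (hf : IsNoncrossing (2 * (i + j + 1)) f)
    (h0 : f 0 = 2 * i + 1) :
    IsNoncrossing (2 * j) fun x => f (x + (2 * i + 2)) - (2 * i + 2) := by
  have hout : ∀ x, 2 * i + 2 ≤ f (x + (2 * i + 2)) := fun x => hf.outer h0 (by omega)
  refine ⟨fun x hx => ?_, fun x hx => ?_, fun x hx => ?_, fun x hx => ?_, fun x hx y hy => ?_⟩
  · have := hf.lt (x + (2 * i + 2)) (by omega)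
    have := hout x
    omega
  · rw [Nat.sub_add_cancel (hout x), hf.involutive _ (by omega), Nat.add_sub_cancel]
  · have := hf.ne_self (x + (2 * i + 2)) (by omega)
    have := hout x
    omega
  · rw [hf.eq_self _ (by omega), Nat.add_sub_cancel]
  · have := hf.noncrossing (x + (2 * i + 2)) (by omega) (y + (2 * i + 2)) (by omega)
    have := hout x
    have := hout y
    omega

/-- Matchings with a given strand at `0` are pairs of smaller matchings. -/
def splitEquiv (i j : ℕ) :
    {f : {f : ℕ → ℕ // IsNoncrossing (2 * (i + j + 1)) f} // f.1 0 = 2 * i + 1} ≃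
      {g : ℕ → ℕ // IsNoncrossing (2 * i) g} × {h : ℕ → ℕ // IsNoncrossing (2 * j) h} where
  toFun f := (⟨_, isNoncrossing_innerPart f.1.2 f.2⟩, ⟨_, isNoncrossing_outerPart f.1.2 f.2⟩)
  invFun p := ⟨⟨_, isNoncrossing_join p.1.2 p.2.2⟩, joinMatching_zero i p.1.1 p.2.1⟩
  left_inv := by
    rintro ⟨⟨f, hf⟩, h0⟩
    simp only at h0
    apply Subtype.ext
    apply Subtype.ext
    funext x
    simp only
    rcases cases_of_join i x with rfl | rfl | ⟨y, hy, rfl⟩ | ⟨y, rfl⟩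
    · rw [joinMatching_zero, h0]
    · rw [joinMatching_mid, ← h0, hf.involutive 0 (by omega)]
    · rw [joinMatching_inner _ _ hy, if_pos hy]
      have := hf.inner h0 (x := y + 1) (by omega)
      omega
    · rw [joinMatching_outer]
      have := hf.outer h0 (x := y + (2 * i + 2)) (by omega)
      omega
  right_inv := by
    rintro ⟨⟨g, hg⟩, ⟨h, hh⟩⟩
    refine Prod.ext (Subtype.ext (funext fun x => ?_)) (Subtype.ext (funext fun x => ?_))
    · simp only
      split_ifs with hx
      · rw [joinMatching_inner _ _ hx, Nat.add_sub_cancel]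
      · exact (hg.eq_self x (by omega)).symm
    · simp only
      rw [joinMatching_outer, Nat.add_sub_cancel]

instance (k : ℕ) : Finite {f : ℕ → ℕ // IsNoncrossing (2 * k) f} :=
  Finite.of_equiv _ (connectionEquiv k)

/-- The Catalan recurrence, sorting matchings by the partner `2 * i + 1` of `0`. Matchings are
functions on `ℕ`, so that cutting and joining only shift arguments; being the identity off the
endpoints makes them unique. -/
theorem card_isNoncrossing (k : ℕ) :
    Nat.card {f : ℕ → ℕ // IsNoncrossing (2 * k) f} = catalan k := by
  induction k using Nat.strong_induction_on with
  | _ k ih =>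
  rcases k with _ | k
  · rw [catalan_zero, Nat.card_eq_one_iff_unique]
    refine ⟨⟨fun f g => Subtype.ext (funext fun x => ?_)⟩, ⟨⟨id, ?_⟩⟩⟩
    · rw [f.2.eq_self x (by omega), g.2.eq_self x (by omega)]
    · constructor <;> simp
  · choose φ hφ hφ' using fun f : {f : ℕ → ℕ // IsNoncrossing (2 * (k + 1)) f} => f.2.exists_eq
    have e := Nat.card_congr (Equiv.sigmaFiberEquiv
      (fun f => (⟨φ f, Nat.lt_succ_of_le (hφ f)⟩ : Fin (k + 1))))
    rw [← e, Nat.card_sigma, catalan_succ]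
    refine Finset.sum_congr rfl fun i _ => ?_
    have hi : (i : ℕ) + (k - i) = k := by omega
    rw [← ih i (by omega), ← ih (k - i) (by omega), ← Nat.card_prod]
    refine Nat.card_congr (Equiv.trans ?_ (splitEquiv i (k - i)))
    rw [hi]
    refine Equiv.subtypeEquivRight fun f => ?_
    rw [Fin.ext_iff, hφ' f]
    simp only
    omega

theorem card_connection (k : ℕ) : Fintype.card (Connection k) = catalan k := by
  rw [← Nat.card_eq_fintype_card, Nat.card_congr (connectionEquiv k), card_isNoncrossing]

end

noncomputable section

/-! ### Symmetries of the endpoints -/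

theorem cyclicallyOrdered_finRotate {n : ℕ} (x y z : Fin n) :
    CyclicallyOrdered (finRotate n x) (finRotate n y) (finRotate n z) ↔
      CyclicallyOrdered x y z := by
  rcases n with _ | n
  · exact x.elim0
  · have rx := coe_finRotate x
    have ry := coe_finRotate y
    have rz := coe_finRotate z
    simp only [Nat.succ_eq_add_one, Fin.ext_iff, Fin.val_last] at rx ry rz
    have b1 := x.isLt
    have b2 := y.isLt
    have b3 := z.isLt
    simp only [CyclicallyOrdered, Fin.lt_def]
    split_ifs at rx ry rz <;> omega

theorem cyclicallyOrdered_rev {n : ℕ} (x y z : Fin n) :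
    CyclicallyOrdered (Fin.rev x) (Fin.rev y) (Fin.rev z) ↔ CyclicallyOrdered z y x := by
  simp only [CyclicallyOrdered, Fin.rev_lt_rev]
  tauto

/-- The two sides become the two arcs of the circle, a form in which invariance under rotations and
reflections is visible. The ends of the strand, which the outer side of the definition includes,
agree automatically. -/
theorem hasRemovableStrand_iff {k : ℕ} {r : Connection k × Connection k} :
    HasRemovableStrand r ↔ ∃ i, r.1.1 i = r.2.1 i ∧
      ((∀ m, CyclicallyOrdered i m (r.1.1 i) → r.1.1 m = r.2.1 m) ∨
       (∀ m, CyclicallyOrdered (r.1.1 i) m i → r.1.1 m = r.2.1 m)) := by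
  obtain ⟨σ, σ'⟩ := r
  refine exists_congr fun i => ?_
  unfold IsRemovableStrand
  refine and_congr_right fun hi => ?_
  simp only at hi ⊢
  have hi' : σ.1 (σ.1 i) = σ'.1 (σ.1 i) := by rw [σ.2.1, hi, σ'.2.1]
  have hout : ∀ u v : Fin (2 * k), u < v → σ.1 u = σ'.1 u → σ.1 v = σ'.1 v →
      ((∀ m, ¬ (u < m ∧ m < v) → σ.1 m = σ'.1 m) ↔
        (∀ m, CyclicallyOrdered v m u → σ.1 m = σ'.1 m)) := by
    intro u v huv hu hv
    refine forall_congr' fun m => ?_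
    by_cases h1 : m = u
    · simp [h1, hu]
    by_cases h2 : m = v
    · simp [h2, hv]
    refine imp_congr_left ?_
    unfold CyclicallyOrdered
    grind
  have hin : ∀ u v : Fin (2 * k), u < v →
      ((∀ m, (u < m ∧ m < v) → σ.1 m = σ'.1 m) ↔
        (∀ m, CyclicallyOrdered u m v → σ.1 m = σ'.1 m)) := by
    intro u v huv
    refine forall_congr' fun m => imp_congr_left ?_
    unfold CyclicallyOrdered
    grind
  rcases lt_or_gt_of_ne (σ.2.2.1 i) with h | h
  · rw [min_eq_right h.le, max_eq_left h.le, hin _ _ h, hout _ _ h hi' hi]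
    exact or_comm
  · rw [min_eq_left h.le, max_eq_right h.le, hin _ _ h, hout _ _ h hi hi']

/-- The permutation `E` of the connections is induced by a permutation `e` of the endpoints that
preserves or reverses the cyclic order. -/
structure IsSymmetry {k : ℕ} (e : Equiv.Perm (Fin (2 * k))) (E : Equiv.Perm (Connection k)) :
    Prop where
  apply : ∀ α i, (E α).1 (e i) = e (α.1 i)
  cyclic : (∀ x y z, CyclicallyOrdered (e x) (e y) (e z) ↔ CyclicallyOrdered x y z) ∨
    (∀ x y z, CyclicallyOrdered (e x) (e y) (e z) ↔ CyclicallyOrdered z y x)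

namespace IsSymmetry

variable {k : ℕ} {e : Equiv.Perm (Fin (2 * k))} {E : Equiv.Perm (Connection k)}

theorem loopNumber_eq (h : IsSymmetry e E) (α β : Connection k) :
    loopNumber (E α) (E β) = loopNumber α β :=
  (Components.card_congr e (fun x => (h.apply α x).symm) fun x => (h.apply β x).symm).symm

theorem hasRemovableStrand (h : IsSymmetry e E) (σ σ' : Connection k) :
    HasRemovableStrand (E σ, E σ') ↔ HasRemovableStrand (σ, σ') := by
  rw [hasRemovableStrand_iff, hasRemovableStrand_iff, ← e.exists_congr_right]
  refine exists_congr fun i => ?_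
  simp only [h.apply, e.apply_eq_iff_eq]
  refine and_congr_right fun _ => ?_
  have hall : ∀ u v, (∀ m, CyclicallyOrdered (e u) m (e v) → (E σ).1 m = (E σ').1 m) ↔
      ∀ m, CyclicallyOrdered (e u) (e m) (e v) → σ.1 m = σ'.1 m := by
    intro u v
    rw [← e.forall_congr_right]
    simp only [h.apply, e.apply_eq_iff_eq]
  rw [hall, hall]
  rcases h.cyclic with hc | hc
  · simp only [hc]
  · simp only [hc]
    exact or_comm

end IsSymmetry

theorem rotate_apply {k : ℕ} (α : Connection k) (i : Fin (2 * k)) :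
    (rotate k α).1 (finRotate (2 * k) i) = finRotate (2 * k) (α.1 i) := by
  change finRotate (2 * k) (α.1 ((finRotate (2 * k)).symm (finRotate (2 * k) i))) = _
  rw [Equiv.symm_apply_apply]

theorem isSymmetry_rotate (k : ℕ) : IsSymmetry (finRotate (2 * k)) (rotate k) :=
  ⟨rotate_apply, Or.inl cyclicallyOrdered_finRotate⟩

/-- The mirror image of a connection. -/
def mirrorFun {k : ℕ} (α : Connection k) : Connection k :=
  ⟨fun i => Fin.rev (α.1 (Fin.rev i)), fun i => by simp only [Fin.rev_rev, α.2.1],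
    fun i h => α.2.2.1 (Fin.rev i) (by
      rw [← Fin.rev_rev (α.1 (Fin.rev i))]
      exact congrArg Fin.rev h), fun i j h => by
      refine α.2.2.2 (α.1 (Fin.rev j)) (α.1 (Fin.rev i)) ⟨?_, ?_, ?_⟩
      · exact Fin.rev_lt_rev.mp h.2.2
      · rw [α.2.1, ← Fin.rev_lt_rev, Fin.rev_rev]
        exact h.2.1
      · rw [α.2.1, α.2.1]
        exact Fin.rev_lt_rev.mpr h.1⟩

theorem mirrorFun_involutive {k : ℕ} : Function.Involutive (mirrorFun (k := k)) := fun α =>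
  Subtype.ext (funext fun i => by simp only [mirrorFun, Fin.rev_rev])

/-- Reflection of the endpoints, acting on connections. -/
def mirror (k : ℕ) : Equiv.Perm (Connection k) := mirrorFun_involutive.toPerm

theorem mirror_mirror {k : ℕ} (α : Connection k) : mirror k (mirror k α) = α :=
  mirrorFun_involutive α

theorem mirror_apply {k : ℕ} (α : Connection k) (i : Fin (2 * k)) :
    (mirror k α).1 (Fin.rev i) = Fin.rev (α.1 i) := by
  change Fin.rev (α.1 (Fin.rev (Fin.rev i))) = _
  rw [Fin.rev_rev]

theorem isSymmetry_mirror (k : ℕ) : IsSymmetry Fin.revPerm (mirror k) :=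
  ⟨mirror_apply, Or.inr cyclicallyOrdered_rev⟩

theorem finRotate_rev_finRotate {n : ℕ} (x : Fin n) :
    finRotate n (Fin.rev (finRotate n x)) = Fin.rev x := by
  rcases n with _ | n
  · exact x.elim0
  · have rx := coe_finRotate x
    have ry := coe_finRotate (Fin.rev (finRotate (n + 1) x))
    have b := x.isLt
    simp only [Nat.succ_eq_add_one, Fin.ext_iff, Fin.val_last, Fin.val_rev] at rx ry ⊢
    split_ifs at rx ry <;> omega

/-- The dihedral relation. It makes the mirrored dual of a rotation-invariant operator
rotation-invariant. -/
theorem rotate_mirror_rotate {k : ℕ} (α : Connection k) :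
    rotate k (mirror k (rotate k α)) = mirror k α := by
  apply Subtype.ext
  funext x
  obtain ⟨y, rfl⟩ := Fin.rev_involutive.surjective x
  rw [mirror_apply, ← finRotate_rev_finRotate y, rotate_apply, mirror_apply, rotate_apply,
    finRotate_rev_finRotate]

theorem rotate_pow_apply {k : ℕ} (j : ℕ) (α : Connection k) (i : Fin (2 * k)) :
    ((rotate k ^ j) α).1 ((finRotate (2 * k) ^ j) i) = (finRotate (2 * k) ^ j) (α.1 i) := by
  induction j with
  | zero => rfl
  | succ j ih =>
    rw [pow_succ', pow_succ', Equiv.Perm.mul_apply, Equiv.Perm.mul_apply, rotate_apply, ih]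
    rfl

/-! ### Fully extended connections -/

theorem exists_finRotate_pow_zero {n : ℕ} (x : Fin (n + 1)) :
    ∃ j : ℕ, (finRotate (n + 1) ^ j) 0 = x := by
  refine ⟨x, Fin.ext ?_⟩
  have h : ∀ j ≤ n, (((finRotate (n + 1) ^ j) 0 : Fin (n + 1)) : ℕ) = j := by
    intro j
    induction j with
    | zero => intro _; rfl
    | succ j ih =>
      intro hj
      have h := ih (by omega)
      rw [pow_succ', Equiv.Perm.mul_apply, coe_finRotate_of_ne_last, h]
      intro h'
      rw [h', Fin.val_last] at h
      omega
  exact h x (by omega)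

theorem cyclicallyOrdered_finRotate_pow {n : ℕ} (j : ℕ) (x y z : Fin n) :
    CyclicallyOrdered ((finRotate n ^ j) x) ((finRotate n ^ j) y) ((finRotate n ^ j) z) ↔
      CyclicallyOrdered x y z := by
  induction j with
  | zero => rfl
  | succ j ih =>
    rw [pow_succ']
    simp only [Equiv.Perm.mul_apply]
    rw [cyclicallyOrdered_finRotate, ih]

/-- An injective map that preserves the cyclic order is a rotation. -/
theorem exists_eq_finRotate_pow {n : ℕ} {g : Fin n → Fin n} (hg : Function.Injective g)
    (hc : ∀ x y z, CyclicallyOrdered x y z → CyclicallyOrdered (g x) (g y) (g z)) :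
    ∃ j : ℕ, ∀ x, g x = (finRotate n ^ j) x := by
  rcases n with _ | n
  · exact ⟨0, fun x => x.elim0⟩
  obtain ⟨j, hj⟩ := exists_finRotate_pow_zero (g 0)
  refine ⟨j, ?_⟩
  -- Normalised to fix `0`, the map preserves the linear order that the cyclic order induces from
  -- `0`, so it is the identity.
  set f : Fin (n + 1) → Fin (n + 1) := fun x => (finRotate (n + 1) ^ j).symm (g x) with hf
  have hgf : ∀ x, g x = (finRotate (n + 1) ^ j) (f x) := fun x =>
    ((finRotate (n + 1) ^ j).apply_symm_apply _).symm
  have hf0 : f 0 = 0 := by rw [hf]; simp only [← hj, Equiv.symm_apply_apply]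
  have hfi : Function.Injective f := (Equiv.injective _).comp hg
  have hfc : ∀ x y z, CyclicallyOrdered x y z → CyclicallyOrdered (f x) (f y) (f z) := by
    intro x y z h
    rw [← cyclicallyOrdered_finRotate_pow j, ← hgf, ← hgf, ← hgf]
    exact hc x y z h
  have hpos : ∀ x, 0 < x → 0 < f x := by
    intro x hx
    rw [Fin.pos_iff_ne_zero] at hx ⊢
    exact fun h => hx (hfi (h.trans hf0.symm))
  have hmono : StrictMono f := by
    intro x y hxy
    by_cases hx : x = 0
    · rw [hx, hf0]
      exact hpos y (hx ▸ hxy)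
    · have h1 := hfc 0 x y (Or.inl ⟨Fin.pos_iff_ne_zero.mpr hx, hxy⟩)
      rw [hf0] at h1
      have h2 := hpos y ((Fin.pos_iff_ne_zero.mpr hx).trans hxy)
      unfold CyclicallyOrdered at h1
      grind
  have hid : f = id := (hmono.range_inj strictMono_id).mp (by
    rw [(Finite.injective_iff_surjective.mp hfi).range_eq, Set.range_id])
  intro x
  rw [hgf, hid, id]

/-- The strands give an injection that reverses the cyclic order. Precomposed with `Fin.rev` it
preserves that order, hence is a rotation. -/
theorem ExteriorConnection.IsFullyExtended.exists_compose_rotate {k : ℕ}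
    {γ : ExteriorConnection k k} (hγ : γ.IsFullyExtended) :
    ∃ j : ℕ, ∀ δ, γ.compose ((rotate k ^ j) δ) = mirror k δ := by
  choose f hf using hγ.1
  have hfi : Function.Injective f := by
    intro x y h
    have h1 := toFun_symm (hf x)
    rw [h, toFun_symm (hf y)] at h1
    exact (Sum.inl_injective h1).symm
  obtain ⟨j, hj⟩ := exists_eq_finRotate_pow (g := fun x => f (Fin.rev x))
    (hfi.comp Fin.rev_injective) fun x y z h =>
      γ.reverses_order _ _ _ _ _ _ (hf _) (hf _) (hf _) ((cyclicallyOrdered_rev z y x).mpr h)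
  refine ⟨j, fun δ => composesTo_iff.mp fun i => ?_⟩
  obtain ⟨y, rfl⟩ := Fin.rev_involutive.surjective i
  rw [mirror_apply]
  set q := Sum.map id ((rotate k ^ j) δ).1 with hq
  have h1 : ∀ x, (Quot.mk _ (Sum.inl x) : Components γ.toFun q) = Quot.mk _ (Sum.inr (f x)) := by
    intro x
    rw [← hf, Components.mk_left]
  have h2 := Components.mk_right (p := γ.toFun) (q := q) (Sum.inr (f (Fin.rev y)))
  rw [h1, h1, ← h2, hj, hj, ← rotate_pow_apply, hq]
  rfl

theorem ExteriorConnection.IsFullyExtended.closedLoops_eq_zero {k : ℕ}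
    {γ : ExteriorConnection k k} (hγ : γ.IsFullyExtended) (β : Connection k) :
    γ.closedLoops β = 0 :=
  ExteriorConnection.closedLoops_eq_zero β hγ.2

end

noncomputable section

open ExteriorConnection

variable {k : ℕ} {d : ℂ}

/-! ### The pairing of operators -/

/-- The functional on operators dual to `X`: the entry of `dual k d X` at `(β', β)` is the pairing
of `X` with `|β'⟩⟨β|`. -/
def dual (k : ℕ) (d : ℂ) : DiscOperator k →ₗ[ℂ] DiscOperator k :=
  LinearMap.mulLeft ℂ (overlapMatrix k (conj d)) ∘ₗ LinearMap.mulRight ℂ (overlapMatrix k d)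

theorem dual_apply (X : DiscOperator k) (β' β : Connection k) :
    dual k d X β' β = ∑ α' : Connection k, ∑ α : Connection k,
      (conj d) ^ loopNumber α' β' * d ^ loopNumber α β * X α' α := by
  change (overlapMatrix k (conj d) * (X * overlapMatrix k d)) β' β = _
  simp only [Matrix.mul_apply, overlapMatrix, Matrix.of_apply, Finset.mul_sum]
  refine Finset.sum_congr rfl fun α' _ => Finset.sum_congr rfl fun α _ => ?_
  rw [loopNumber_comm β' α']
  ring

theorem isUnit_overlapMatrix_conj (h : IsUnit (overlapMatrix k d)) :
    IsUnit (overlapMatrix k (conj d)) := by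
  have e : overlapMatrix k (conj d) = (starRingEnd ℂ).mapMatrix (overlapMatrix k d) := by
    ext α β
    simp [overlapMatrix]
  rw [e]
  exact h.map _

theorem dual_bijective (h : IsUnit (overlapMatrix k d)) : Function.Bijective (dual k d) := by
  have hinj : Function.Injective (dual k d) := fun X Y hXY => by
    have h1 : overlapMatrix k (conj d) * (X * overlapMatrix k d) =
        overlapMatrix k (conj d) * (Y * overlapMatrix k d) := hXY
    exact h.mul_right_cancel ((isUnit_overlapMatrix_conj h).mul_left_cancel h1)
  exact ⟨hinj, LinearMap.surjective_of_injective hinj⟩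

/-- The loop count splits by `totalLoops_eq`: the factor that depends on the connection in `A` sums
to an entry of the dual, the rest is a weight of the connection in `B`. -/
theorem correlator_eq {n : ℕ} (γ : ExteriorConnection k n) (X : DiscOperator k)
    (Y : DiscOperator n) : correlator d γ X Y = ∑ β' : Connection n, ∑ β : Connection n,
      dual k d X (γ.compose β') (γ.compose β) *
        ((conj d) ^ γ.closedLoops β' * d ^ γ.closedLoops β * Y β' β) := by
  have hswap : correlator d γ X Y = ∑ β' : Connection n, ∑ β : Connection n,
      ∑ α' : Connection k, ∑ α : Connection k,
        (conj d) ^ γ.totalLoops α' β' * d ^ γ.totalLoops α β * X α' α * Y β' β := by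
    unfold correlator
    simp only [← Finset.sum_product']
    exact Finset.sum_nbij' (fun p => (p.2.2.1, p.2.2.2, p.1, p.2.1))
      (fun p => (p.2.2.1, p.2.2.2, p.1, p.2.1)) (by simp) (by simp) (by simp) (by simp) (by simp)
  rw [hswap]
  refine Finset.sum_congr rfl fun β' _ => Finset.sum_congr rfl fun β _ => ?_
  rw [dual_apply, Finset.sum_mul]
  refine Finset.sum_congr rfl fun α' _ => ?_
  rw [Finset.sum_mul]
  refine Finset.sum_congr rfl fun α _ => ?_
  rw [totalLoops_eq, totalLoops_eq, pow_add, pow_add]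
  ring

/-- Excision tests the dual at a single removable pair, while a self contact only ever reaches
removable pairs. No invertibility is involved. -/
theorem mem_watermelon_iff {W : DiscOperator k} :
    W ∈ watermelon k d ↔ ∀ σ σ', HasRemovableStrand (σ, σ') → dual k d W σ σ' = 0 := by
  constructor
  · intro hW σ σ' hr
    obtain ⟨n, γ, β, β', hγ, h1, h2, h3⟩ := exists_excision hr
    have h := hW n γ hγ (ketBra (β, β'))
    rw [correlator_eq, Finset.sum_eq_single β, Finset.sum_eq_single β'] at h
    · simpa [ketBra, h1, h2, h3] using h
    · intro b _ hb
      simp [ketBra, hb.symm]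
    · simp
    · intro b _ hb
      refine Finset.sum_eq_zero fun c _ => ?_
      simp [ketBra, hb.symm]
    · simp
  · intro h n γ hγ OB
    rw [correlator_eq]
    refine Finset.sum_eq_zero fun β' _ => Finset.sum_eq_zero fun β _ => ?_
    rw [h _ _ (hasRemovableStrand_compose hγ β' β), zero_mul]

theorem dual_symmetry {e : Equiv.Perm (Fin (2 * k))} {E : Equiv.Perm (Connection k)}
    (h : IsSymmetry e E) {X : DiscOperator k} (hX : ∀ σ σ', X (E σ) (E σ') = X σ σ')
    (σ σ' : Connection k) : dual k d X (E σ) (E σ') = dual k d X σ σ' := by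
  rw [dual_apply, dual_apply, ← Equiv.sum_comp E]
  refine Finset.sum_congr rfl fun α' _ => ?_
  rw [← Equiv.sum_comp E]
  refine Finset.sum_congr rfl fun α _ => ?_
  rw [h.loopNumber_eq, h.loopNumber_eq, hX]

/-! ### Rotation-invariant operators -/

theorem rotateOperator_apply (X : DiscOperator k) (σ σ' : Connection k) :
    rotateOperator k X (rotate k σ) (rotate k σ') = X σ σ' := by
  change X ((rotate k).symm (rotate k σ)) ((rotate k).symm (rotate k σ')) = _
  rw [Equiv.symm_apply_apply, Equiv.symm_apply_apply]

theorem rotateOperator_eq_self_iff {X : DiscOperator k} :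
    rotateOperator k X = X ↔ ∀ σ σ', X (rotate k σ) (rotate k σ') = X σ σ' := by
  constructor
  · intro h σ σ'
    conv_lhs => rw [← h]
    exact rotateOperator_apply X σ σ'
  · intro h
    ext σ σ'
    obtain ⟨τ, rfl⟩ := (rotate k).surjective σ
    obtain ⟨τ', rfl⟩ := (rotate k).surjective σ'
    rw [rotateOperator_apply, h]

theorem mem_spinWatermelon_zero_iff {W : DiscOperator k} :
    W ∈ spinWatermelon k 0 d ↔
      W ∈ watermelon k d ∧ ∀ σ σ', W (rotate k σ) (rotate k σ') = W σ σ' := by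
  unfold spinWatermelon
  rw [Submodule.mem_inf, Module.End.mem_eigenspace_iff, ← rotateOperator_eq_self_iff]
  simp

/-- `dual` commutes with rotations because loop numbers do not change, and injectivity transfers
invariance back to `X`. -/
theorem dual_rotate_iff (h : IsUnit (overlapMatrix k d)) {X : DiscOperator k} :
    (∀ σ σ', dual k d X (rotate k σ) (rotate k σ') = dual k d X σ σ') ↔
      ∀ σ σ', X (rotate k σ) (rotate k σ') = X σ σ' := by
  refine ⟨fun hX => ?_, dual_symmetry (isSymmetry_rotate k)⟩
  rw [← rotateOperator_eq_self_iff]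
  apply (dual_bijective h).1
  ext σ σ'
  obtain ⟨τ, rfl⟩ := (rotate k).surjective σ
  obtain ⟨τ', rfl⟩ := (rotate k).surjective σ'
  rw [hX, dual_apply, dual_apply, ← Equiv.sum_comp (rotate k)]
  refine Finset.sum_congr rfl fun α' _ => ?_
  rw [← Equiv.sum_comp (rotate k)]
  refine Finset.sum_congr rfl fun α _ => ?_
  rw [(isSymmetry_rotate k).loopNumber_eq, (isSymmetry_rotate k).loopNumber_eq,
    rotateOperator_apply]

/-- Restriction of an operator to the pairs without removable strands. -/
def restrictReconnection (k : ℕ) : DiscOperator k →ₗ[ℂ] (Reconnection k → ℂ) where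
  toFun X r := X r.1.1 r.1.2
  map_add' _ _ := rfl
  map_smul' _ _ := rfl

theorem restrictReconnection_eq_zero_iff {X : DiscOperator k} :
    restrictReconnection k X = 0 ↔ X ∈ removableSpan k := by
  rw [mem_removableSpan_iff]
  exact ⟨fun h σ σ' hr => congrFun h ⟨(σ, σ'), hr⟩, fun h => funext fun r => h _ _ r.2⟩

open Classical in
/-- Extension by zero of a function on the pairs without removable strands. -/
def extendReconnection (f : Reconnection k → ℂ) : DiscOperator k :=
  Matrix.of fun σ σ' => if h : HasRemovableStrand (σ, σ') then 0 else f ⟨(σ, σ'), h⟩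

theorem extendReconnection_of_removable (f : Reconnection k → ℂ) {σ σ' : Connection k}
    (h : HasRemovableStrand (σ, σ')) : extendReconnection f σ σ' = 0 := by
  simp [extendReconnection, h]

theorem extendReconnection_apply (f : Reconnection k → ℂ) (r : Reconnection k) :
    extendReconnection f r.1.1 r.1.2 = f r := by
  have h : ¬ HasRemovableStrand (r.1.1, r.1.2) := r.2
  simp [extendReconnection, h]

/-- Restriction of an operator to representatives of the topological types. -/
def restrictType (k : ℕ) : DiscOperator k →ₗ[ℂ] (TopologicalType k → ℂ) where
  toFun X t := X t.out.1.1 t.out.1.2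
  map_add' _ _ := rfl
  map_smul' _ _ := rfl

/-- The rotation of a pair without removable strands. -/
def rotateReconnection (r : Reconnection k) : Reconnection k :=
  ⟨(rotate k r.1.1, rotate k r.1.2), fun h =>
    r.2 (((isSymmetry_rotate k).hasRemovableStrand r.1.1 r.1.2).mp h)⟩

theorem mk_rotateReconnection (r : Reconnection k) :
    (Quot.mk _ (rotateReconnection r) : TopologicalType k) = Quot.mk _ r :=
  (Quot.sound (r := fun r s : Reconnection k => s.1 = (rotate k r.1.1, rotate k r.1.2)) rfl).symm

theorem eq_of_topologicalType_eq {X : DiscOperator k}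
    (hX : ∀ σ σ', X (rotate k σ) (rotate k σ') = X σ σ') {r s : Reconnection k}
    (h : (Quot.mk _ r : TopologicalType k) = Quot.mk _ s) :
    X r.1.1 r.1.2 = X s.1.1 s.1.2 := by
  have h' := congrArg (Quot.lift (fun r : Reconnection k => X r.1.1 r.1.2) (by
    intro a b hab
    simp only [hab]
    exact (hX _ _).symm)) h
  exact h'

theorem restrictType_mk {X : DiscOperator k}
    (hX : ∀ σ σ', X (rotate k σ) (rotate k σ') = X σ σ') (r : Reconnection k) :
    restrictType k X (Quot.mk _ r) = X r.1.1 r.1.2 :=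
  eq_of_topologicalType_eq hX (Quot.out_eq _)

/-! ### Dimensions -/

/-- A watermelon operator is determined by its pairings with the reconnection operators. -/
def watermelonEquiv (h : IsUnit (overlapMatrix k d)) :
    watermelon k d ≃ₗ[ℂ] (Reconnection k → ℂ) :=
  LinearEquiv.ofBijective (restrictReconnection k ∘ₗ dual k d ∘ₗ (watermelon k d).subtype) (by
    constructor
    · rw [← LinearMap.ker_eq_bot, LinearMap.ker_eq_bot']
      rintro ⟨W, hW⟩ h0
      have h1 : dual k d W = 0 := by
        ext σ σ'
        by_cases hr : HasRemovableStrand (σ, σ')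
        · exact mem_watermelon_iff.mp hW σ σ' hr
        · exact congrFun h0 ⟨(σ, σ'), hr⟩
      exact Subtype.ext ((dual_bijective h).1 (h1.trans (map_zero _).symm))
    · intro f
      -- Zeros on the removable pairs are the watermelon condition; the other entries of the dual
      -- are free.
      obtain ⟨W, hW⟩ := (dual_bijective h).2 (extendReconnection f)
      refine ⟨⟨W, mem_watermelon_iff.mpr fun σ σ' hr => ?_⟩, funext fun r => ?_⟩
      · rw [hW, extendReconnection_of_removable f hr]
      · change dual k d W r.1.1 r.1.2 = f r
        rw [hW, extendReconnection_apply])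

theorem finrank_watermelon (h : IsUnit (overlapMatrix k d)) :
    Module.finrank ℂ (watermelon k d) = Nat.card (Reconnection k) := by
  classical
  rw [(watermelonEquiv h).finrank_eq, Module.finrank_fintype_fun_eq_card, Nat.card_eq_fintype_card]

instance : Finite (TopologicalType k) := Quot.finite _

instance : Fintype (TopologicalType k) := Fintype.ofFinite _

/-- A spin-zero watermelon operator is determined by its pairings with one reconnection operator of
each topological type. -/
def spinWatermelonEquiv (h : IsUnit (overlapMatrix k d)) :
    spinWatermelon k 0 d ≃ₗ[ℂ] (TopologicalType k → ℂ) :=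
  LinearEquiv.ofBijective (restrictType k ∘ₗ dual k d ∘ₗ (spinWatermelon k 0 d).subtype) (by
    constructor
    · rw [← LinearMap.ker_eq_bot, LinearMap.ker_eq_bot']
      rintro ⟨W, hW⟩ h0
      rw [mem_spinWatermelon_zero_iff] at hW
      have h1 : dual k d W = 0 := by
        ext σ σ'
        by_cases hr : HasRemovableStrand (σ, σ')
        · exact mem_watermelon_iff.mp hW.1 σ σ' hr
        · have h2 := restrictType_mk ((dual_rotate_iff h).mpr hW.2) ⟨(σ, σ'), hr⟩
          rw [Matrix.zero_apply, ← h2]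
          exact congrFun h0 _
      exact Subtype.ext ((dual_bijective h).1 (h1.trans (map_zero _).symm))
    · intro f
      -- A function constant on topological types, extended by zero, is rotation-invariant because
      -- rotation preserves removability.
      obtain ⟨W, hW⟩ := (dual_bijective h).2 (extendReconnection fun r => f (Quot.mk _ r))
      have hrot : ∀ σ σ', dual k d W (rotate k σ) (rotate k σ') = dual k d W σ σ' := by
        intro σ σ'
        rw [hW]
        by_cases hr : HasRemovableStrand (σ, σ')
        · rw [extendReconnection_of_removable _ hr, extendReconnection_of_removable _
            (((isSymmetry_rotate k).hasRemovableStrand σ σ').mpr hr)]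
        · have h1 := extendReconnection_apply (fun r => f (Quot.mk _ r)) ⟨(σ, σ'), hr⟩
          have h2 := extendReconnection_apply (fun r => f (Quot.mk _ r))
            (rotateReconnection ⟨(σ, σ'), hr⟩)
          rw [mk_rotateReconnection] at h2
          exact h2.trans h1.symm
      refine ⟨⟨W, mem_spinWatermelon_zero_iff.mpr ⟨mem_watermelon_iff.mpr fun σ σ' hr => ?_,
        (dual_rotate_iff h).mp hrot⟩⟩, funext fun t => ?_⟩
      · rw [hW, extendReconnection_of_removable _ hr]
      · change dual k d W t.out.1.1 t.out.1.2 = f t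
        rw [hW, extendReconnection_apply, Quot.out_eq])

theorem finrank_spinWatermelon_zero (h : IsUnit (overlapMatrix k d)) :
    Module.finrank ℂ (spinWatermelon k 0 d) = Nat.card (TopologicalType k) := by
  rw [(spinWatermelonEquiv h).finrank_eq, Module.finrank_fintype_fun_eq_card,
    Nat.card_eq_fintype_card]

theorem card_reconnection_add_finrank_removableSpan (k : ℕ) :
    Nat.card (Reconnection k) + Module.finrank ℂ (removableSpan k) = catalan k ^ 2 := by
  classical
  have hsurj : Function.Surjective (restrictReconnection k) := fun f =>
    ⟨extendReconnection f, funext fun r => extendReconnection_apply f r⟩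
  have hker : LinearMap.ker (restrictReconnection k) = removableSpan k := by
    ext X
    rw [LinearMap.mem_ker, restrictReconnection_eq_zero_iff]
  have h := LinearMap.finrank_range_add_finrank_ker (restrictReconnection k)
  rw [LinearMap.range_eq_top.mpr hsurj, finrank_top, hker, Module.finrank_fintype_fun_eq_card,
    Module.finrank_matrix, Module.finrank_self, card_connection] at h
  rw [Nat.card_eq_fintype_card, h]
  ring

/-! ### Degeneracy -/

theorem coupling_pos (d : ℂ) : 0 < coupling d := by
  refine div_pos (Real.arccos_pos.mpr ?_) Real.pi_pos
  nlinarith [sq_nonneg ‖d‖]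

/-- The two scaling dimensions differ by `l ^ 2 / (2 * g * k ^ 2)` with `g` positive, so only `l =
0` survives the filter. -/
theorem degeneracy_eq (hk : 1 ≤ k) (d : ℂ) :
    degeneracy k d = Module.finrank ℂ (spinWatermelon k 0 d) := by
  classical
  have hg := coupling_pos d
  have hk' : (0 : ℝ) < k := by exact_mod_cast hk
  have hiff : ∀ l : ℤ, spinScalingDim (coupling d) k l = scalingDim (coupling d) k ↔ l = 0 := by
    intro l
    have h : spinScalingDim (coupling d) k l =
        scalingDim (coupling d) k + l ^ 2 / (2 * coupling d * k ^ 2) := by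
      unfold spinScalingDim scalingDim
      field_simp
      ring
    rw [h, add_eq_left, div_eq_zero_iff]
    constructor
    · rintro (h | h)
      · exact_mod_cast pow_eq_zero_iff two_ne_zero |>.mp h
      · exact absurd h (by positivity)
    · rintro rfl
      simp
  unfold degeneracy
  rw [Finset.sum_eq_single_of_mem 0]
  · rw [Finset.mem_filter, hiff, Finset.mem_Ioc]
    exact ⟨⟨by omega, by omega⟩, rfl⟩
  · intro l hl hl0
    rw [Finset.mem_filter, hiff] at hl
    exact absurd hl.2 hl0

/-! ### Generic bases -/

-- An element of $S_k$ is a vector of coefficients on the removable pairs, and the watermelon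
-- condition says that the Gram matrix annihilates this vector.
open Classical in
theorem eq_zero_of_mem_watermelon_of_mem_removableSpan
    (h : (removableGram k d).det ≠ 0) {W : DiscOperator k} (hW : W ∈ watermelon k d)
    (hS : W ∈ removableSpan k) : W = 0 := by
  have h0 : Matrix.vecMul
      (fun r : {r : Connection k × Connection k // HasRemovableStrand r} => W r.1.1 r.1.2)
      (removableGram k d) = 0 := by
    funext s
    have h1 := mem_watermelon_iff.mp hW s.1.1 s.1.2 s.2
    rw [dual_apply, ← Finset.sum_product', Finset.univ_product_univ] at h1
    rw [Pi.zero_apply, ← h1]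
    simp only [Matrix.vecMul, dotProduct, removableGram, Matrix.of_apply]
    rw [← Finset.sum_filter_add_sum_filter_not Finset.univ
      (fun r : Connection k × Connection k => HasRemovableStrand r)]
    rw [Finset.sum_eq_zero (s := Finset.univ.filter fun r => ¬ HasRemovableStrand r), add_zero,
      ← Finset.sum_subtype_eq_sum_filter]
    · refine Finset.sum_congr (by ext; simp) fun r _ => by ring
    · intro r hr
      rw [mem_removableSpan_iff.mp hS r.1 r.2 (Finset.mem_filter.mp hr).2, mul_zero]
  have h2 := Matrix.eq_zero_of_vecMul_eq_zero h h0
  ext σ σ'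
  by_cases hr : HasRemovableStrand (σ, σ')
  · exact congrFun h2 ⟨(σ, σ'), hr⟩
  · exact mem_removableSpan_iff.mp hS σ σ' hr

/-- By `hdisj`, passing to the entries on reconnection pairs is injective on watermelon operators,
and the dimensions agree. The basis is the preimage of the unit vectors, as the kernel of the
restriction is $S_k$. -/
theorem exists_watermelon_basis (h : IsUnit (overlapMatrix k d))
    (hdisj : ∀ W ∈ watermelon k d, W ∈ removableSpan k → W = 0) :
    ∃ b : Module.Basis (Reconnection k) ℂ (watermelon k d),
      ∀ r : Reconnection k, ∀ W ∈ watermelon k d,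
        W - ketBra r.1 ∈ removableSpan k ↔ W = b r := by
  classical
  set f : watermelon k d →ₗ[ℂ] (Reconnection k → ℂ) :=
    restrictReconnection k ∘ₗ (watermelon k d).subtype with hf
  have hinj : Function.Injective f := by
    rw [← LinearMap.ker_eq_bot, LinearMap.ker_eq_bot']
    rintro ⟨W, hW⟩ h0
    exact Subtype.ext (hdisj W hW (restrictReconnection_eq_zero_iff.mp h0))
  set e := LinearEquiv.ofInjectiveOfFinrankEq f hinj (watermelonEquiv h).finrank_eq
  refine ⟨Module.Basis.ofEquivFun e, fun r W hW => ?_⟩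
  have h1 : restrictReconnection k (ketBra r.1) = Pi.single r 1 := by
    funext s
    change Matrix.single r.1.1 r.1.2 (1 : ℂ) s.1.1 s.1.2 = _
    rw [Matrix.single_apply, Pi.single_apply]
    refine if_congr ?_ rfl rfl
    rw [Subtype.ext_iff, Prod.ext_iff]
    exact ⟨fun h => ⟨h.1.symm, h.2.symm⟩, fun h => ⟨h.1.symm, h.2.symm⟩⟩
  rw [← restrictReconnection_eq_zero_iff, map_sub, h1, sub_eq_zero]
  have h2 : restrictReconnection k W = e ⟨W, hW⟩ := rfl
  rw [h2, ← LinearEquiv.eq_symm_apply, Module.Basis.coe_ofEquivFun, Subtype.ext_iff]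

theorem typeSum_apply (t : TopologicalType k) (s : Reconnection k) :
    typeSum t s.1.1 s.1.2 = open Classical in if Quot.mk _ s = t then 1 else 0 := by
  classical
  unfold typeSum
  rw [Matrix.sum_apply, Finset.sum_eq_single s]
  · split_ifs <;> simp [ketBra]
  · intro r _ hr
    split_ifs
    · rw [ketBra, Matrix.single_apply, if_neg]
      rintro ⟨h1, h2⟩
      exact hr (Subtype.ext (Prod.ext h1 h2))
    · rfl
  · simp

/-- As for $W_R$, but one entry per topological type suffices, since the operators are
rotation-invariant. -/
theorem exists_spinWatermelon_basis (h : IsUnit (overlapMatrix k d))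
    (hdisj : ∀ W ∈ watermelon k d, W ∈ removableSpan k → W = 0) :
    ∃ c : Module.Basis (TopologicalType k) ℂ (spinWatermelon k 0 d),
      ∀ t : TopologicalType k, ∀ W ∈ spinWatermelon k 0 d,
        W - typeSum t ∈ removableSpan k ↔ W = c t := by
  classical
  set f : spinWatermelon k 0 d →ₗ[ℂ] (TopologicalType k → ℂ) :=
    restrictType k ∘ₗ (spinWatermelon k 0 d).subtype with hf
  have hinj : Function.Injective f := by
    rw [← LinearMap.ker_eq_bot, LinearMap.ker_eq_bot']
    rintro ⟨W, hW⟩ h0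
    have hW' := mem_spinWatermelon_zero_iff.mp hW
    refine Subtype.ext (hdisj W hW'.1 (restrictReconnection_eq_zero_iff.mp (funext fun r => ?_)))
    exact (restrictType_mk hW'.2 r).symm.trans (congrFun h0 _)
  set e := LinearEquiv.ofInjectiveOfFinrankEq f hinj (spinWatermelonEquiv h).finrank_eq
  refine ⟨Module.Basis.ofEquivFun e, fun t W hW => ?_⟩
  have hW' := (mem_spinWatermelon_zero_iff.mp hW).2
  have h2 : e ⟨W, hW⟩ = restrictType k W := rfl
  have h3 : W = Module.Basis.ofEquivFun e t ↔ restrictType k W = Pi.single t 1 := by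
    rw [← h2, ← LinearEquiv.eq_symm_apply, Module.Basis.coe_ofEquivFun, Subtype.ext_iff]
  rw [h3, ← restrictReconnection_eq_zero_iff, map_sub, sub_eq_zero]
  constructor
  · intro h4
    funext t'
    have h5 := congrFun h4 t'.out
    change W t'.out.1.1 t'.out.1.2 = typeSum t t'.out.1.1 t'.out.1.2 at h5
    rw [typeSum_apply, Quot.out_eq] at h5
    rw [Pi.single_apply]
    exact h5
  · intro h4
    funext s
    change W s.1.1 s.1.2 = typeSum t s.1.1 s.1.2
    rw [typeSum_apply, ← restrictType_mk hW', h4, Pi.single_apply]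

/-! ### Diagonalization of the two-point functions -/

/-- The two-point function `⟨X Y⟩` for the fully extended connection that reflects the endpoints. -/
def twoPoint (k : ℕ) (d : ℂ) : LinearMap.BilinForm ℂ (DiscOperator k) :=
  LinearMap.mk₂ ℂ (fun X Y => ∑ σ : Connection k, ∑ σ' : Connection k,
    dual k d X (mirror k σ) (mirror k σ') * Y σ σ')
    (fun X X' Y => by simp only [map_add, Matrix.add_apply, add_mul, Finset.sum_add_distrib])
    (fun c X Y => by
      simp only [map_smul, Matrix.smul_apply, smul_eq_mul, Finset.mul_sum, mul_assoc])
    (fun X Y Y' => by simp only [Matrix.add_apply, mul_add, Finset.sum_add_distrib])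
    (fun c X Y => by
      simp only [Matrix.smul_apply, smul_eq_mul, Finset.mul_sum, mul_left_comm])

theorem twoPoint_apply (X Y : DiscOperator k) :
    twoPoint k d X Y = ∑ σ : Connection k, ∑ σ' : Connection k,
      dual k d X (mirror k σ) (mirror k σ') * Y σ σ' := rfl

/-- Every fully extended `γ` differs from the reflection by a rotation, which the invariant `Y`
absorbs. One form thus serves all `γ`. -/
theorem correlator_of_isFullyExtended {γ : ExteriorConnection k k} (hγ : γ.IsFullyExtended)
    (X : DiscOperator k) {Y : DiscOperator k}
    (hY : ∀ σ σ', Y (rotate k σ) (rotate k σ') = Y σ σ') :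
    correlator d γ X Y = twoPoint k d X Y := by
  obtain ⟨j, hj⟩ := hγ.exists_compose_rotate
  have hYj : ∀ σ σ', Y ((rotate k ^ j) σ) ((rotate k ^ j) σ') = Y σ σ' := by
    clear hj
    induction j with
    | zero => exact fun _ _ => rfl
    | succ j ih =>
      intro σ σ'
      rw [pow_succ', Equiv.Perm.mul_apply, Equiv.Perm.mul_apply, hY, ih]
  rw [correlator_eq, twoPoint_apply, ← Equiv.sum_comp (rotate k ^ j)]
  refine Finset.sum_congr rfl fun σ _ => ?_
  rw [← Equiv.sum_comp (rotate k ^ j)]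
  refine Finset.sum_congr rfl fun σ' _ => ?_
  rw [hγ.closedLoops_eq_zero, hγ.closedLoops_eq_zero, hj, hj, hYj]
  simp

theorem loopNumber_mirror (α β : Connection k) :
    loopNumber α (mirror k β) = loopNumber β (mirror k α) := by
  rw [← (isSymmetry_mirror k).loopNumber_eq, mirror_mirror, loopNumber_comm]

theorem twoPoint_comm (X Y : DiscOperator k) : twoPoint k d X Y = twoPoint k d Y X := by
  simp only [twoPoint_apply, dual_apply, Finset.sum_mul]
  simp only [← Finset.sum_product']
  refine Finset.sum_nbij' (fun p => (p.2.2.1, p.2.2.2, p.1, p.2.1))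
      (fun p => (p.2.2.1, p.2.2.2, p.1, p.2.1)) (by simp) (by simp) (by simp) (by simp) ?_
  rintro ⟨a, b, c, e⟩ _
  simp only
  rw [loopNumber_mirror c a, loopNumber_mirror e b]
  ring

theorem dual_mirror_rotate {X : DiscOperator k}
    (hX : ∀ σ σ', X (rotate k σ) (rotate k σ') = X σ σ') (σ σ' : Connection k) :
    dual k d X (mirror k (rotate k σ)) (mirror k (rotate k σ')) =
      dual k d X (mirror k σ) (mirror k σ') := by
  rw [← dual_symmetry (isSymmetry_rotate k) hX, rotate_mirror_rotate, rotate_mirror_rotate]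

/-- The mirrored dual `Z` of `X` vanishes on removable pairs and is constant on each topological
type. Pairing `X` with $W_t$ gives the size of `t` times the value of `Z` on `t`, so `Z` vanishes
and invertibility gives `X = 0`. -/
theorem eq_zero_of_twoPoint_eq_zero (h : IsUnit (overlapMatrix k d))
    (hdisj : ∀ W ∈ watermelon k d, W ∈ removableSpan k → W = 0) {X : DiscOperator k}
    (hX : X ∈ spinWatermelon k 0 d)
    (h0 : ∀ Y ∈ spinWatermelon k 0 d, twoPoint k d X Y = 0) : X = 0 := by
  classical
  obtain ⟨c, hc⟩ := exists_spinWatermelon_basis h hdisj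
  have hX' := mem_spinWatermelon_zero_iff.mp hX
  set Z : DiscOperator k := Matrix.of fun σ σ' => dual k d X (mirror k σ) (mirror k σ') with hZ
  have hZrot : ∀ σ σ', Z (rotate k σ) (rotate k σ') = Z σ σ' := dual_mirror_rotate hX'.2
  have hZrem : ∀ σ σ', HasRemovableStrand (σ, σ') → Z σ σ' = 0 := fun σ σ' hr =>
    mem_watermelon_iff.mp hX'.1 _ _ (((isSymmetry_mirror k).hasRemovableStrand σ σ').mpr hr)
  have hpair : ∀ Y : DiscOperator k, twoPoint k d X Y =
      ∑ r : Reconnection k, Z r.1.1 r.1.2 * Y r.1.1 r.1.2 := by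
    intro Y
    rw [twoPoint_apply, ← Finset.sum_product', Finset.univ_product_univ,
      ← Finset.sum_filter_add_sum_filter_not Finset.univ
      (fun r : Connection k × Connection k => HasRemovableStrand r),
      Finset.sum_eq_zero (s := Finset.univ.filter fun r => HasRemovableStrand r), zero_add,
      ← Finset.sum_subtype_eq_sum_filter]
    · exact Finset.sum_congr (by ext; simp) fun r _ => rfl
    · intro r hr
      have := hZrem r.1 r.2 (Finset.mem_filter.mp hr).2
      rw [hZ, Matrix.of_apply] at this
      rw [this, zero_mul]
  have hZrec : ∀ r : Reconnection k, Z r.1.1 r.1.2 = 0 := by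
    intro s
    set t : TopologicalType k := Quot.mk _ s with ht
    have h1 := h0 (c t) (c t).2
    have h2 := mem_removableSpan_iff.mp ((hc t (c t) (c t).2).mpr rfl)
    have h3 : ∀ r : Reconnection k, Z r.1.1 r.1.2 * (c t : DiscOperator k) r.1.1 r.1.2 =
        if (Quot.mk _ r : TopologicalType k) = t then Z s.1.1 s.1.2 else 0 := by
      intro r
      have h4 := h2 r.1.1 r.1.2 r.2
      rw [Matrix.sub_apply, sub_eq_zero, typeSum_apply] at h4
      rw [h4]
      split_ifs with h5
      · rw [mul_one, eq_of_topologicalType_eq hZrot h5]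
      · rw [mul_zero]
    rw [hpair, Finset.sum_congr rfl fun r _ => h3 r, ← Finset.sum_filter, Finset.sum_const,
      nsmul_eq_mul, mul_eq_zero] at h1
    refine h1.resolve_left ?_
    rw [Nat.cast_eq_zero, Finset.card_eq_zero, ← Ne, ← Finset.nonempty_iff_ne_empty]
    exact ⟨s, by simp [ht]⟩
  apply (dual_bijective h).1
  rw [map_zero]
  ext σ σ'
  have hZ0 : Z (mirror k σ) (mirror k σ') = 0 := by
    by_cases hr : HasRemovableStrand (mirror k σ, mirror k σ')
    · exact hZrem _ _ hr
    · exact hZrec ⟨_, hr⟩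
  rwa [hZ, Matrix.of_apply, mirror_mirror, mirror_mirror] at hZ0

/-- A symmetric bilinear form over `ℂ` has an orthogonal basis, and non-degeneracy keeps its
diagonal values away from zero. -/
theorem exists_orthogonal_spinWatermelon_basis (h : IsUnit (overlapMatrix k d))
    (hdisj : ∀ W ∈ watermelon k d, W ∈ removableSpan k → W = 0) :
    ∃ e : Module.Basis (TopologicalType k) ℂ (spinWatermelon k 0 d),
      ∀ γ : ExteriorConnection k k, γ.IsFullyExtended →
        ∀ s t : TopologicalType k, correlator d γ (e s) (e t) ≠ 0 ↔ s = t := by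
  classical
  set B : LinearMap.BilinForm ℂ (spinWatermelon k 0 d) :=
    (twoPoint k d).restrict (spinWatermelon k 0 d) with hB
  have hsymm : LinearMap.IsSymm B := ⟨fun X Y => twoPoint_comm _ _⟩
  have hsep : B.SeparatingLeft := fun X hX =>
    Subtype.ext (eq_zero_of_twoPoint_eq_zero h hdisj X.2 fun Y hY => hX ⟨Y, hY⟩)
  have : Invertible (2 : ℂ) := invertibleOfNonzero two_ne_zero
  obtain ⟨v, hv⟩ := LinearMap.BilinForm.exists_orthogonal_basis hsymm
  have hv' := hv.not_isOrtho_basis_self_of_separatingLeft hsep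
  have hcard : Fintype.card (Fin (Module.finrank ℂ (spinWatermelon k 0 d))) =
      Fintype.card (TopologicalType k) := by
    rw [Fintype.card_fin, finrank_spinWatermelon_zero h, Nat.card_eq_fintype_card]
  refine ⟨v.reindex (Fintype.equivOfCardEq hcard), fun γ hγ s t => ?_⟩
  rw [correlator_of_isFullyExtended hγ _ (mem_spinWatermelon_zero_iff.mp (Subtype.coe_prop _)).2,
    Module.Basis.reindex_apply, Module.Basis.reindex_apply]
  constructor
  · intro hne
    by_contra hst
    exact hne (hv fun h => hst ((Equiv.injective _) h))
  · rintro rfl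
    exact hv' _

end

/-! ### The main theorem -/

theorem mainTheorem5 :
    -- the overlap matrices are invertible for generic `d`
    (∀ k : ℕ, {d : ℂ | ¬ IsUnit (overlapMatrix k d)}.Finite) ∧
    ({d : ℂ | ∃ k : ℕ, ¬ IsUnit (overlapMatrix k d)}.Countable) ∧
    -- the images of the self-contact connections are the operators with removable strands
    (∀ (k : ℕ) (d : ℂ), 1 ≤ k → selfContactImages k d = removableSpan k) ∧
    -- counting, whenever the overlap matrix is invertible
    (∀ (k : ℕ) (d : ℂ), 1 ≤ k → IsUnit (overlapMatrix k d) →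
      Module.finrank ℂ (watermelon k d) = Nat.card (Reconnection k) ∧
      Module.finrank ℂ (watermelon k d) + Module.finrank ℂ (removableSpan k) = catalan k ^ 2 ∧
      Module.finrank ℂ (spinWatermelon k 0 d) = Nat.card (TopologicalType k) ∧
      (‖d‖ ^ 2 ≤ 2 → degeneracy k d = Nat.card (TopologicalType k))) ∧
    -- the correspondence between reconnection operators and watermelon operators
    (∀ k : ℕ, 1 ≤ k → ForGeneric fun d =>
      IsUnit (overlapMatrix k d) ∧
      (∃ b : Module.Basis (Reconnection k) ℂ (watermelon k d),
        ∀ r : Reconnection k, ∀ W ∈ watermelon k d,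
          W - ketBra r.1 ∈ removableSpan k ↔ W = b r) ∧
      (∃ c : Module.Basis (TopologicalType k) ℂ (spinWatermelon k 0 d),
        ∀ t : TopologicalType k, ∀ W ∈ spinWatermelon k 0 d,
          W - typeSum t ∈ removableSpan k ↔ W = c t) ∧
      (∃ e : Module.Basis (TopologicalType k) ℂ (spinWatermelon k 0 d),
        ∀ γ : ExteriorConnection k k, γ.IsFullyExtended →
          ∀ s t : TopologicalType k, correlator d γ (e s) (e t) ≠ 0 ↔ s = t)) := by
  refine ⟨finite_not_isUnit_overlapMatrix, countable_not_isUnit_overlapMatrix,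
    fun k d _ => selfContactImages_eq k d, fun k d hk h => ⟨finrank_watermelon h, ?_,
      finrank_spinWatermelon_zero h, fun _ => ?_⟩, fun k _ => ?_⟩
  · rw [finrank_watermelon h, card_reconnection_add_finrank_removableSpan]
  · rw [degeneracy_eq hk, finrank_spinWatermelon_zero h]
  -- The exceptional polynomial is the product of the determinants of $M^k$ and of the Gram matrix
  -- of $S_k$.
  · refine ((forGeneric_isUnit_overlapMatrix k).and (forGeneric_removableGram k)).mono
      fun d hd => ?_
    have hdisj : ∀ W ∈ watermelon k d, W ∈ removableSpan k → W = 0 := fun W =>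
      eq_zero_of_mem_watermelon_of_mem_removableSpan hd.2
    exact ⟨hd.1, exists_watermelon_basis hd.1 hdisj, exists_spinWatermelon_basis hd.1 hdisj,
      exists_orthogonal_spinWatermelon_basis hd.1 hdisj⟩
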